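/- Fix a real nome $0<p<1$ and let $$[x]=\tfrac12\sum_{n\in\mathbb Z}(-1)^{n-\frac12}p^{(n+\frac12)^2}e^{-(2n+1)x}\qquad(x\in\mathbb C,\ (-1)^{n-1/2}=e^{i\pi(n-1/2)}).$$ Let $\gamma,\tau\in\mathbb C$, $L\ge 1$, $x=(x_1,\dots,x_L)\in\mathbb C^L$ and $\mu=(\mu_1,\dots,\mu_L)\in\mathbb C^L$. A height configuration is a family $h_{i,j}=\tau+n_{i,j}\gamma$, $n_{i,j}\in\mathbb Z$, $1\le i,j\le L+1$, in which the integers at neighbouring sites differ by $\pm1$, with domain-wall boundary conditions $n_{1,j}=n_{j,1}=L+1-j$ and $n_{L+1,j}=n_{j,L+1}=j-1$. The plaquette with corners $(i,j),(i,j+1),(i+1,j),(i+1,j+1)$ has, with $u=x_i-\mu_j$, $s=n_{i+1,j}-n_{i,j}\in\{1,-1\}$ and $H=h_{i+1,j}+\gamma$, the weight $$w_{ij}=\begin{cases}[u+\gamma] & n_{i,j+1}=n_{i,j}-s,\ n_{i+1,j+1}=n_{i,j},\\ [H+s\gamma]\,[u]\,[H]^{-1} & n_{i,j+1}=n_{i,j}+s,\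 n_{i+1,j+1}=n_{i,j}+2s,\\ [H+su]\,[\gamma]\,[H]^{-1} & n_{i,j+1}=n_{i,j}+s,\ n_{i+1,j+1}=n_{i,j}.\end{cases}$$ The partition function of the 8VSOS model with domain-wall boundaries is $\mathcal Z_\tau(x_1,\dots,x_L)=\sum_{h}\prod_{i,j=1}^L w_{ij}$, the sum running over all height configurations. Let $x_0,x_{\bar 0}\in\mathbb C$, write $\mathrm X=(x_1,\dots,x_L)$, and let $\mathrm X_i^{\alpha}$ be $\mathrm X$ with the entry $x_i$ replaced by $x_\alpha$ ($\alpha\in\{0,\bar0\}$). Suppose that no denominator vanishes, that is, $[\tau+k\gamma]\ne0$ for $1\le k\le L+1$, $[x_i-x_j]\ne0$ for $i\neq j$, and $[x_0-x_j]$, $[x_{\bar0}-x_j]$, $[x_0-\mu_j+\gamma]$, $[x_{\bar0}-\mu_j+\gamma]$ are nonzero for $1\le j\le L$. Then $$\mathcal M_0\,\mathcal Z_\tau(\mathrm X)+\sum_{i=1}^L\mathcal N_i\,\mathcal Z_\tau(\mathrm X_i^0)+\sum_{i=1}^L\bar{\mathcal N}_i\,\mathcal Z_\tau(\mathrm X_i^{\bar0})=0,$$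 where $$\mathcal M_0=\prod_{j=1}^L\frac{[x_{\bar0}-\mu_j][x_{\bar0}-x_j+\gamma]}{[x_{\bar0}-\mu_j+\gamma][x_{\bar0}-x_j]}-\prod_{j=1}^L\frac{[x_0-\mu_j][x_0-x_j+\gamma]}{[x_0-\mu_j+\gamma][x_0-x_j]},$$ $$\mathcal N_i=\frac{[\gamma][\tau+(L+1)\gamma+x_0-x_i]}{[\tau+(L+1)\gamma][x_0-x_i]}\prod_{j=1}^L\frac{[x_i-\mu_j]}{[x_0-\mu_j+\gamma]}\prod_{j\ne i}\frac{[x_i-x_j+\gamma]}{[x_i-x_j]},$$ $$\bar{\mathcal N}_i=\frac{[\gamma][\tau+(L+1)\gamma+x_{\bar0}-x_i]}{[\tau+(L+1)\gamma][x_i-x_{\bar0}]}\prod_{j=1}^L\frac{[x_i-\mu_j]}{[x_{\bar0}-\mu_j+\gamma]}\prod_{j\ne i}\frac{[x_i-x_j+\gamma]}{[x_i-x_j]}.$$ -/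

import Mathlib

namespace SOS

noncomputable section

/-- The odd theta function `[x] = (1/2) ∑_{n ∈ ℤ} (-1)^(n-1/2) p^((n+1/2)^2) e^(-(2n+1)x)` of nome
`p`, with the principal branch `(-1)^(n-1/2) = e^(iπ(n-1/2))`. -/
def theta (p : ℝ) (x : ℂ) : ℂ :=
  (1 / 2 : ℂ) * ∑' n : ℤ,
    (-1 : ℂ) ^ ((n : ℂ) - 1 / 2) * ((p ^ (((n : ℝ) + 1 / 2) ^ 2) : ℝ) : ℂ) *
      Complex.exp (-(2 * (n : ℂ) + 1) * x)

/-- Statistical weight of the plaquette with corner heights `τ + n γ`, where the integers `n` are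
laid out as
```
  c d   at sites   (i+1,j)  (i+1,j+1)
  a b              (i,j)    (i,j+1)
```
(so `c`, `d` form the upper row) and `u = x_i - μ_j`. Neighbouring integers differ by `±1`; with
`H = τ + (c + 1) γ` and the sign `s = c - a = ±1` the six allowed plaquettes have weights
* `[u + γ]`               if `c = a + s`, `d = a`, `b = a - s`;
* `[H + s γ] [u] / [H]`   if `c = b = a + s`, `d = a + 2 s`;
* `[H + s u] [γ] / [H]`   if `c = b = a + s`, `d = a`. -/
def weight (p : ℝ) (γ τ u : ℂ) (a b c d : ℤ) : ℂ :=
  let H : ℂ := τ + ((c : ℂ) + 1) * γ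
  let s : ℂ := (c : ℂ) - (a : ℂ)
  if c ≠ b ∧ a = d then theta p (u + γ)
  else if c = b ∧ a ≠ d then theta p (H + s * γ) * theta p u / theta p H
  else if c = b ∧ a = d then theta p (H + s * u) * theta p γ / theta p H
  else 0

/-- Height configurations with domain-wall boundaries on the `(L+1) × (L+1)` lattice of sites,
encoded by the integers `n i j` with `h_{i+1,j+1} = τ + (n i j) γ` (indices here start at `0`):
neighbouring integers differ by `±1`, the first row and column read `L, L-1, …, 0`, the last row
and column read `0, 1, …, L`. -/
structure IsConfig (L : ℕ) (n : Fin (L + 1) → Fin (L + 1) → ℤ) : Prop where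
  vert : ∀ (i : Fin L) (j : Fin (L + 1)), |n i.succ j - n i.castSucc j| = 1
  horiz : ∀ (i : Fin (L + 1)) (j : Fin L), |n i j.succ - n i j.castSucc| = 1
  first_row : ∀ j : Fin (L + 1), n 0 j = (L : ℤ) - (j : ℤ)
  first_col : ∀ i : Fin (L + 1), n i 0 = (L : ℤ) - (i : ℤ)
  last_row : ∀ j : Fin (L + 1), n (Fin.last L) j = (j : ℤ)
  last_col : ∀ i : Fin (L + 1), n i (Fin.last L) = (i : ℤ)

/-- A function on `Fin (L+1)` with steps `±1` stays within `k` of its initial value after `k`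
steps. -/
theorem abs_sub_zero_le {L : ℕ} (f : Fin (L + 1) → ℤ)
    (hf : ∀ j : Fin L, |f j.succ - f j.castSucc| = 1) (j : Fin (L + 1)) :
    |f j - f 0| ≤ (j : ℤ) := by
  induction j using Fin.induction with
  | zero => simp
  | succ j ih =>
    have h := hf j
    have h2 := abs_sub_le (f j.succ) (f j.castSucc) (f 0)
    simp only [Fin.val_succ, Fin.val_castSucc] at *
    push_cast
    linarith

/-- There are finitely many height configurations. -/
theorem finite_config (L : ℕ) : {n | IsConfig L n}.Finite := by
  have hfin : {n : Fin (L + 1) → Fin (L + 1) → ℤ |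
      ∀ i, n i ∈ {f | ∀ j, f j ∈ Set.Icc (-(L : ℤ)) (2 * (L : ℤ))}}.Finite :=
    Set.Finite.pi' fun _ => Set.Finite.pi' fun _ => Set.finite_Icc _ _
  refine hfin.subset ?_
  intro n hn i j
  have h := abs_sub_zero_le (n i) (hn.horiz i) j
  have h0 := hn.first_col i
  have hj := j.is_le
  have hi := i.is_le
  rw [abs_le] at h
  constructor <;> omega

/-- The domain-wall partition function
`Z_τ(x_1, …, x_L | μ_1, …, μ_L) = ∑_h ∏_{i,j} w_{ij}`. -/
def Z {L : ℕ} (p : ℝ) (γ τ : ℂ) (μ x : Fin L → ℂ) : ℂ :=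
  ∑ n ∈ (finite_config L).toFinset, ∏ i : Fin L, ∏ j : Fin L,
    weight p γ τ (x i - μ j)
      (n i.castSucc j.castSucc) (n i.castSucc j.succ)
      (n i.succ j.castSucc) (n i.succ j.succ)

/-- The coefficient of `Z_τ(X)`. -/
def coeffM {L : ℕ} (p : ℝ) (γ : ℂ) (μ x : Fin L → ℂ) (x₀ xb : ℂ) : ℂ :=
  ∏ j, (theta p (xb - μ j) * theta p (xb - x j + γ)) /
      (theta p (xb - μ j + γ) * theta p (xb - x j)) -
  ∏ j, (theta p (x₀ - μ j) * theta p (x₀ - x j + γ)) /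
      (theta p (x₀ - μ j + γ) * theta p (x₀ - x j))

/-- The coefficient of `Z_τ(X_i^0)`. -/
def coeffN {L : ℕ} (p : ℝ) (γ τ : ℂ) (μ x : Fin L → ℂ) (x₀ : ℂ) (i : Fin L) : ℂ :=
  theta p γ * theta p (τ + ((L : ℂ) + 1) * γ + x₀ - x i) /
      (theta p (τ + ((L : ℂ) + 1) * γ) * theta p (x₀ - x i)) *
    (∏ j, theta p (x i - μ j) / theta p (x₀ - μ j + γ)) *
    ∏ j ∈ Finset.univ.erase i, theta p (x i - x j + γ) / theta p (x i - x j)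

/-- The coefficient of `Z_τ(X_i^{0̄})`. -/
def coeffNbar {L : ℕ} (p : ℝ) (γ τ : ℂ) (μ x : Fin L → ℂ) (xb : ℂ) (i : Fin L) : ℂ :=
  theta p γ * theta p (τ + ((L : ℂ) + 1) * γ + xb - x i) /
      (theta p (τ + ((L : ℂ) + 1) * γ) * theta p (x i - xb)) *
    (∏ j, theta p (x i - μ j) / theta p (xb - μ j + γ)) *
    ∏ j ∈ Finset.univ.erase i, theta p (x i - x j + γ) / theta p (x i - x j)

end

end SOS

/-!
The partition function is a matrix element of a product of `L` row-to-row transfer operators, one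
for each `x_i`, whose rows lower the height at the left end and raise it at the right end
(`Z_eq_stack`). Put below them one more row, of spectral parameter `z`, that raises the height at
both ends. There its only admissible configuration has weight `∏ [z - μ_j + γ]`
(`transfer_descending`), so the enlarged partition function divided by this product does not depend
on `z`.

On the other hand the extra row can be moved to the top of the stack by means of the Yang–Baxter
equation (`transfer_exchange`, `transfer_stack`): while passing the row of `x_i` it either goes
through or exchanges spectral parameters with it. On top it is frozen again
(`transfer_single_ascending`), and what remains is `Z_τ(X)` in the first case and `Z_τ(X_i^z)`, with
`z` in place of `x_i`, in the second. This expresses a quantity independent of `z` as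

  `∏_j [z - μ_j] [z - x_j + γ] / ([z - μ_j + γ] [z - x_j]) Z_τ(X) - ∑_i N_i(z) Z_τ(X_i^z)`

(`relation_of_generic`), and the theorem is the difference of this relation for `z = xb` and
`z = x₀`, since `Nbar_i` is `-N_i` with `xb` in place of `x₀`.

The coefficients in `transfer_stack` are found by induction on the number of rows. The coefficient
of each exchange arises from two ways of performing it, which are combined by the fact that rows
commute and by the three-term theta identity. That identity (`theta_three_term`) also gives the
Yang–Baxter equation (`yang_baxter`), and follows from the series: `[x + y] [x - y]` is a `2 × 2`
minor in functions of `x` and of `y`.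

Heights outside the range allowed by the hypotheses occur in the enlarged lattice, so the relation
is first proved for all `τ` outside a meagre set, where no `[τ + k γ]` vanishes, and extended by
continuity in `τ`.
-/

namespace SOS

open Complex

noncomputable section

/-! ### The theta function: oddness, the three-term identity, regularity -/

/-- The summand of `2 * theta p x`, written as a single exponential. -/
def thetaTerm (p : ℝ) (x : ℂ) (n : ℤ) : ℂ :=
  cexp (Real.pi * I * ((n : ℂ) - 1 / 2) + Real.log p * ((n : ℂ) + 1 / 2) ^ 2 -
    (2 * (n : ℂ) + 1) * x)

theorem theta_eq_tsum {p : ℝ} (hp0 : 0 < p) (x : ℂ) :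
    theta p x = 1 / 2 * ∑' n : ℤ, thetaTerm p x n := by
  unfold theta
  congr 1
  refine tsum_congr fun n => ?_
  rw [Complex.cpow_def_of_ne_zero (by norm_num), Complex.log_neg_one, Real.rpow_def_of_pos hp0,
    Complex.ofReal_exp, ← Complex.exp_add, ← Complex.exp_add, thetaTerm]
  congr 1
  push_cast
  ring

/-- The modular parameter `σ` with `p = e^{iπσ}`. -/
def modulus (p : ℝ) : ℂ := -I * Real.log p / Real.pi

theorem modulus_im_pos {p : ℝ} (hp0 : 0 < p) (hp1 : p < 1) : 0 < (modulus p).im := by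
  have h : modulus p = ((-Real.log p / Real.pi : ℝ) : ℂ) * I := by
    unfold modulus
    push_cast
    ring
  rw [h, Complex.im_ofReal_mul, Complex.I_im, mul_one]
  have := Real.log_neg hp0 hp1
  have := Real.pi_pos
  apply div_pos <;> linarith

theorem thetaTerm_eq (p : ℝ) (x : ℂ) (n : ℤ) :
    thetaTerm p x n = cexp (Real.log p / 4 - Real.pi * I / 2) * cexp (-x) *
      jacobiTheta₂_term n (modulus p / 2 + 1 / 2 + I * x / Real.pi) (modulus p) := by
  have hpi : (Real.pi : ℂ) ≠ 0 := by exact_mod_cast Real.pi_ne_zero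
  rw [thetaTerm, jacobiTheta₂_term, ← Complex.exp_add, ← Complex.exp_add, modulus]
  congr 1
  field_simp
  ring_nf
  simp only [I_sq]
  ring

theorem summable_thetaTerm {p : ℝ} (hp0 : 0 < p) (hp1 : p < 1) (x : ℂ) :
    Summable (thetaTerm p x) := by
  simp_rw [funext (thetaTerm_eq p x)]
  exact ((summable_jacobiTheta₂_term_iff _ _).2 (modulus_im_pos hp0 hp1)).mul_left _

theorem theta_eq_jacobiTheta₂ {p : ℝ} (hp0 : 0 < p) (x : ℂ) :
    theta p x = 1 / 2 * (cexp (Real.log p / 4 - Real.pi * I / 2) * cexp (-x) *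
      jacobiTheta₂ (modulus p / 2 + 1 / 2 + I * x / Real.pi) (modulus p)) := by
  rw [theta_eq_tsum hp0, jacobiTheta₂]
  congr 1
  rw [← tsum_mul_left]
  exact tsum_congr (thetaTerm_eq p x)

theorem differentiable_theta {p : ℝ} (hp0 : 0 < p) (hp1 : p < 1) :
    Differentiable ℂ (theta p) := by
  rw [funext (theta_eq_jacobiTheta₂ hp0)]
  intro x
  have h := differentiableAt_jacobiTheta₂_fst (modulus p / 2 + 1 / 2 + I * x / Real.pi)
    (modulus_im_pos hp0 hp1)
  have h2 : DifferentiableAt ℂ (fun x : ℂ => modulus p / 2 + 1 / 2 + I * x / Real.pi) x := by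
    fun_prop
  have h3 := DifferentiableAt.comp x h h2
  have h4 : DifferentiableAt ℂ (fun x : ℂ => cexp (Real.log p / 4 - Real.pi * I / 2) * cexp (-x))
    x := by fun_prop
  exact (h4.mul h3).const_mul _

theorem continuous_theta {p : ℝ} (hp0 : 0 < p) (hp1 : p < 1) : Continuous (theta p) :=
  (differentiable_theta hp0 hp1).continuous

theorem cexp_pi_mul_of_even {k : ℤ} (hk : Even k) : cexp (Real.pi * I * k) = 1 := by
  obtain ⟨a, rfl⟩ := hk
  have : (Real.pi : ℂ) * I * (a + a : ℤ) = a * (2 * Real.pi * I) := by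
    push_cast
    ring
  rw [this, Complex.exp_int_mul_two_pi_mul_I]

theorem cexp_pi_mul_of_odd {k : ℤ} (hk : Odd k) : cexp (Real.pi * I * k) = -1 := by
  obtain ⟨a, rfl⟩ := hk
  have : (Real.pi : ℂ) * I * (2 * a + 1 : ℤ) = a * (2 * Real.pi * I) + Real.pi * I := by
    push_cast
    ring
  rw [this, Complex.exp_add, Complex.exp_int_mul_two_pi_mul_I, Complex.exp_pi_mul_I, one_mul]

theorem theta_neg {p : ℝ} (hp0 : 0 < p) (x : ℂ) : theta p (-x) = -theta p x := by
  rw [theta_eq_tsum hp0, theta_eq_tsum hp0, ← mul_neg, ← tsum_neg,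
    ← (Equiv.subLeft (-1 : ℤ)).tsum_eq]
  congr 1
  refine tsum_congr fun n => ?_
  -- the index `n ↦ -1 - n` changes the sign `(-1) ^ (n - 1/2)` and nothing else
  have h : thetaTerm p (-x) (-1 - n) =
      cexp (Real.pi * I * (-(2 * n) - 1 : ℤ)) * thetaTerm p x n := by
    rw [thetaTerm, thetaTerm, ← Complex.exp_add]
    congr 1
    push_cast
    ring
  rw [Equiv.subLeft_apply, h, cexp_pi_mul_of_odd (by rw [Int.odd_iff]; omega), neg_one_mul]

/-- The general term of the even theta series `∑ p^{r²/2} e^{-2rx}` of nome `p^{1/2}`. -/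
def evenTerm (p : ℝ) (x : ℂ) (r : ℤ) : ℂ :=
  cexp (Real.log p * (r : ℂ) ^ 2 / 2 - 2 * r * x)

theorem summable_evenTerm {p : ℝ} (hp0 : 0 < p) (hp1 : p < 1) (x : ℂ) :
    Summable (evenTerm p x) := by
  have hpi : (Real.pi : ℂ) ≠ 0 := by exact_mod_cast Real.pi_ne_zero
  have h := (summable_jacobiTheta₂_term_iff (I * x / Real.pi) (modulus p / 2)).2 (by
    have := modulus_im_pos hp0 hp1
    have h2 : (modulus p / 2).im = (modulus p).im / 2 := by simp
    rw [h2]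
    linarith)
  refine h.congr fun n => ?_
  rw [evenTerm, jacobiTheta₂_term, modulus]
  congr 1
  field_simp
  ring_nf
  simp only [I_sq]
  ring

/-- The part of the series `∑ p^{r²/2} e^{-2rx}` with `r` in the set `S`. -/
def partialSeries (p : ℝ) (S : Set ℤ) (x : ℂ) : ℂ := ∑' r : ℤ, S.indicator (evenTerm p x) r

/-- The summand of `theta_mul_theta` at the pair `(r, s)`: it vanishes unless `r` and `s` have
opposite parity, and carries the sign `(-1) ^ r`. -/
def pairTerm (p : ℝ) (x y : ℂ) (z : ℤ × ℤ) : ℂ :=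
  Set.indicator {r | Even r} (evenTerm p x) z.1 * Set.indicator {r | Odd r} (evenTerm p y) z.2 -
    Set.indicator {r | Odd r} (evenTerm p x) z.1 * Set.indicator {r | Even r} (evenTerm p y) z.2

theorem thetaTerm_mul_thetaTerm (p : ℝ) (x y : ℂ) (m n : ℤ) :
    thetaTerm p (x + y) m * thetaTerm p (x - y) n = pairTerm p x y (m + n + 1, m - n) := by
  have hprod : thetaTerm p (x + y) m * thetaTerm p (x - y) n =
      cexp (Real.pi * I * (m + n - 1 : ℤ)) *
        (evenTerm p x (m + n + 1) * evenTerm p y (m - n)) := by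
    simp only [thetaTerm, evenTerm, ← Complex.exp_add]
    congr 1
    push_cast
    ring
  rw [hprod, pairTerm]
  rcases Int.even_or_odd (m + n + 1) with h | h
  · have h1 : ¬ Odd (m + n + 1) := Int.not_odd_iff_even.2 h
    have h2 : Odd (m - n) := by rw [Int.odd_iff]; rw [Int.even_iff] at h; omega
    have h3 : Even (m + n - 1) := by rw [Int.even_iff] at h ⊢; omega
    rw [cexp_pi_mul_of_even h3, Set.indicator_of_mem (s := {r | Even r}) h,
      Set.indicator_of_mem (s := {r | Odd r}) h2, Set.indicator_of_notMem (s := {r | Odd r}) h1]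
    ring
  · have h1 : ¬ Even (m + n + 1) := Int.not_even_iff_odd.2 h
    have h2 : Even (m - n) := by rw [Int.even_iff]; rw [Int.odd_iff] at h; omega
    have h3 : Odd (m + n - 1) := by rw [Int.odd_iff] at h ⊢; omega
    rw [cexp_pi_mul_of_odd h3, Set.indicator_of_notMem (s := {r | Even r}) h1,
      Set.indicator_of_mem (s := {r | Odd r}) h, Set.indicator_of_mem (s := {r | Even r}) h2]
    ring

theorem tsum_thetaTerm_mul (p : ℝ) (x y : ℂ) :
    ∑' z : ℤ × ℤ, thetaTerm p (x + y) z.1 * thetaTerm p (x - y) z.2 =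
      ∑' z : ℤ × ℤ, pairTerm p x y z := by
  have hinj : Function.Injective fun z : ℤ × ℤ => (z.1 + z.2 + 1, z.1 - z.2) := by
    rintro ⟨a, b⟩ ⟨c, d⟩ h
    simp only [Prod.mk.injEq] at h ⊢
    omega
  rw [← hinj.tsum_eq (f := pairTerm p x y)]
  · exact tsum_congr fun z => thetaTerm_mul_thetaTerm p x y z.1 z.2
  · rintro ⟨r, s⟩ h
    have hodd : Odd (r + s) := by
      by_contra hcon
      rw [Int.not_odd_iff_even, Int.even_add] at hcon
      apply h
      by_cases hr : Even r
      · have hs' := hcon.1 hr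
        simp [pairTerm, Set.indicator, ← Int.not_even_iff_odd, hr, hs']
      · have hs' : ¬ Even s := fun t => hr (hcon.2 t)
        simp [pairTerm, Set.indicator, hr, hs']
    obtain ⟨k, hk⟩ := hodd
    exact ⟨(k, r - 1 - k), by simp only [Prod.mk.injEq]; omega⟩

/-- Multiplying the two series and passing to `r = m + n + 1`, `s = m - n`, which run through all
pairs of opposite parity, separates the variables. -/
theorem theta_mul_theta {p : ℝ} (hp0 : 0 < p) (hp1 : p < 1) (x y : ℂ) :
    theta p (x + y) * theta p (x - y) = 1 / 4 *
      (partialSeries p {r | Even r} x * partialSeries p {r | Odd r} y -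
        partialSeries p {r | Odd r} x * partialSeries p {r | Even r} y) := by
  have hs : ∀ (S : Set ℤ) (z : ℂ), Summable fun r => ‖S.indicator (evenTerm p z) r‖ := fun S z =>
    ((summable_evenTerm hp0 hp1 z).indicator S).norm
  have h1 := tsum_mul_tsum_of_summable_norm (hs {r | Even r} x) (hs {r | Odd r} y)
  have h2 := tsum_mul_tsum_of_summable_norm (hs {r | Odd r} x) (hs {r | Even r} y)
  have h3 := tsum_mul_tsum_of_summable_norm (summable_thetaTerm hp0 hp1 (x + y)).norm
    (summable_thetaTerm hp0 hp1 (x - y)).norm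
  have s1 := summable_mul_of_summable_norm (hs {r | Even r} x) (hs {r | Odd r} y)
  have s2 := summable_mul_of_summable_norm (hs {r | Odd r} x) (hs {r | Even r} y)
  have h4 : ∑' z, pairTerm p x y z =
      partialSeries p {r | Even r} x * partialSeries p {r | Odd r} y -
        partialSeries p {r | Odd r} x * partialSeries p {r | Even r} y :=
    (Summable.tsum_sub s1 s2).trans (congrArg₂ (· - ·) h1.symm h2.symm)
  rw [theta_eq_tsum hp0, theta_eq_tsum hp0, ← h4, ← tsum_thetaTerm_mul, ← h3]
  ring

/-- The three-term identity (Weierstrass addition formula): by `theta_mul_theta` it is a Plücker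
relation between `2 × 2` minors. -/
theorem theta_three_term {p : ℝ} (hp0 : 0 < p) (hp1 : p < 1) (x y z w : ℂ) :
    theta p (x + z) * theta p (x - z) * (theta p (y + w) * theta p (y - w)) -
      theta p (x + w) * theta p (x - w) * (theta p (y + z) * theta p (y - z)) =
      theta p (x + y) * theta p (x - y) * (theta p (z + w) * theta p (z - w)) := by
  simp only [theta_mul_theta hp0 hp1]
  ring

/-- The three-term identity in terms of four arguments and their half sum. -/
theorem theta_three_term' {p : ℝ} (hp0 : 0 < p) (hp1 : p < 1) (a b c s : ℂ) :
    theta p a * theta p b * (theta p c * theta p (2 * s - a - b - c)) -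
      theta p (s - a) * theta p (s - b) * (theta p (s - c) * theta p (a + b + c - s)) =
      theta p s * theta p (a + b - s) * (theta p (a + c - s) * theta p (s - b - c)) := by
  have h := theta_three_term hp0 hp1 ((a + b) / 2) (s - (a + b) / 2) ((a - b) / 2)
    (c - s + (a + b) / 2)
  have e1 : (a + b) / 2 + (a - b) / 2 = a := by ring
  have e2 : (a + b) / 2 - (a - b) / 2 = b := by ring
  have e3 : s - (a + b) / 2 + (c - s + (a + b) / 2) = c := by ring
  have e4 : s - (a + b) / 2 - (c - s + (a + b) / 2) = 2 * s - a - b - c := by ring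
  have e5 : (a + b) / 2 + (c - s + (a + b) / 2) = a + b + c - s := by ring
  have e6 : (a + b) / 2 - (c - s + (a + b) / 2) = s - c := by ring
  have e7 : s - (a + b) / 2 + (a - b) / 2 = s - b := by ring
  have e8 : s - (a + b) / 2 - (a - b) / 2 = s - a := by ring
  have e9 : (a + b) / 2 + (s - (a + b) / 2) = s := by ring
  have e10 : (a + b) / 2 - (s - (a + b) / 2) = a + b - s := by ring
  have e11 : (a - b) / 2 + (c - s + (a + b) / 2) = a + c - s := by ring
  have e12 : (a - b) / 2 - (c - s + (a + b) / 2) = s - b - c := by ring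
  rw [e1, e2, e3, e4, e5, e6, e7, e8, e9, e10, e11, e12] at h
  linear_combination h

/-- A theta function that is not identically zero has no open set of zeros. -/
theorem dense_theta_ne_zero {p : ℝ} (hp0 : 0 < p) (hp1 : p < 1) {z : ℂ} (hz : theta p z ≠ 0)
    (c : ℂ) : Dense {x : ℂ | theta p (x + c) ≠ 0} := by
  have han : AnalyticOnNhd ℂ (theta p) Set.univ := fun x _ =>
    (differentiable_theta hp0 hp1).analyticAt x
  have hd : Dense {x : ℂ | theta p x ≠ 0} := by
    intro x
    by_contra hx
    rw [mem_closure_iff_frequently, Filter.not_frequently] at hx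
    refine hz (han.eqOn_zero_of_preconnected_of_eventuallyEq_zero isPreconnected_univ
      (Set.mem_univ x) ?_ (Set.mem_univ z))
    filter_upwards [hx] with y hy
    simpa using hy
  exact hd.preimage (Homeomorph.addRight c).isOpenMap

/-! ### The Yang–Baxter equation for a single plaquette -/

theorem weight_shift (p : ℝ) (γ τ u : ℂ) (k a b c d : ℤ) :
    weight p γ τ u (a + k) (b + k) (c + k) (d + k) = weight p γ (τ + k * γ) u a b c d := by
  have h1 : τ + (((c + k : ℤ) : ℂ) + 1) * γ = τ + k * γ + ((c : ℂ) + 1) * γ := by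
    push_cast
    ring
  have h2 : ((c + k : ℤ) : ℂ) - ((a + k : ℤ) : ℂ) = (c : ℂ) - a := by
    push_cast
    ring
  simp only [weight, h1, h2, ne_eq, add_left_inj]

/-- Reflecting all heights turns `H` into `-H` and `s` into `-s`. -/
theorem weight_neg {p : ℝ} (hp0 : 0 < p) (γ τ u : ℂ) (a b c d : ℤ) :
    weight p γ (-τ - 2 * γ) u (-a) (-b) (-c) (-d) = weight p γ τ u a b c d := by
  have h1 : -τ - 2 * γ + (((-c : ℤ) : ℂ) + 1) * γ = -(τ + ((c : ℂ) + 1) * γ) := by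
    push_cast
    ring
  have h2 : ((-c : ℤ) : ℂ) - ((-a : ℤ) : ℂ) = -((c : ℂ) - a) := by
    push_cast
    ring
  have h3 : ∀ H s v : ℂ, -H + -(s * v) = -(H + s * v) := fun H s v => by ring
  simp only [weight, h1, h2, h3, ne_eq, neg_inj, neg_mul, theta_neg hp0, neg_div_neg_eq]

/-- The three-term identity with all twelve arguments free up to linear relations. -/
theorem theta_rel {p : ℝ} (hp0 : 0 < p) (hp1 : p < 1) {a b c d a' b' c' d' e f k : ℂ} (s : ℂ)
    (hd : d = 2 * s - a - b - c) (ha' : a' = s - a) (hb' : b' = s - b) (hc' : c' = s - c)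
    (hd' : d' = a + b + c - s) (he : e = a + b - s) (hf : f = a + c - s) (hk : k = s - b - c) :
    theta p a * theta p b * (theta p c * theta p d) -
      theta p a' * theta p b' * (theta p c' * theta p d') =
      theta p s * theta p e * (theta p f * theta p k) := by
  subst hd ha' hb' hc' hd' he hf hk
  exact theta_three_term' hp0 hp1 a b c s

theorem theta_rel_cross {p : ℝ} (hp0 : 0 < p) (hp1 : p < 1) (H γ x y : ℂ) :
    theta p (y + γ) * theta p (x - y + γ) * (theta p (H + x) * theta p (H)) -
      theta p (H + (x - y)) * theta p (H + y) * (theta p (γ) * theta p (x + γ)) =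
      (theta p (H + γ + x) * theta p (H - γ) * (theta p (y) * theta p (x - y))) := by
  have h : theta p (y + γ) * theta p (x - y + γ) * (theta p (H + x) * theta p (H)) -
      theta p (H + (x - y)) * theta p (H + y) * (theta p (γ) * theta p (x + γ)) =
      theta p (H + γ + x) * theta p (-(H - γ)) * (theta p (y) * theta p (-(x - y))) := by
    apply theta_rel hp0 hp1 <;> ring
  simp only [theta_neg hp0] at h
  linear_combination h

theorem theta_rel_turn {p : ℝ} (hp0 : 0 < p) (hp1 : p < 1) (H γ x y : ℂ) :
    theta p (y + γ) * theta p (x) * (theta p (H + γ + (x - y)) * theta p (H)) -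
      theta p (H + (x - y)) * theta p (H + γ) * (theta p (y) * theta p (x + γ)) =
      (theta p (H + γ + x) * theta p (H - y) * (theta p (γ) * theta p (x - y))) := by
  have h : theta p (y + γ) * theta p (x) * (theta p (H + γ + (x - y)) * theta p (H)) -
      theta p (H + (x - y)) * theta p (H + γ) * (theta p (y) * theta p (x + γ)) =
      theta p (H + γ + x) * theta p (-(H - y)) * (theta p (γ) * theta p (-(x - y))) := by
    apply theta_rel hp0 hp1 <;> ring
  simp only [theta_neg hp0] at h
  linear_combination h

theorem theta_rel_left {p : ℝ} (hp0 : 0 < p) (hp1 : p < 1) (H γ x y : ℂ) :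
    theta p (H + γ + y) * theta p (x) * (theta p (x - y + γ) * theta p (H)) -
      theta p (x - y) * theta p (H + γ) * (theta p (H + y) * theta p (x + γ)) =
      (theta p (H + γ + x) * theta p (y) * (theta p (γ) * theta p (H + (y - x)))) := by
  have h : theta p (H + γ + y) * theta p (x) * (theta p (x - y + γ) * theta p (H)) -
      theta p (x - y) * theta p (H + γ) * (theta p (H + y) * theta p (x + γ)) =
      theta p (H + γ + x) * theta p (y) * (theta p (γ) * theta p (H + (y - x))) := by
    apply theta_rel hp0 hp1 <;> ring
  linear_combination h

theorem theta_rel_right {p : ℝ} (hp0 : 0 < p) (hp1 : p < 1) (H γ x y : ℂ) :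
    theta p (H + (y - x)) * theta p (x) * (theta p (y + γ) * theta p (H + γ)) -
      theta p (x + γ) * theta p (H + γ + (y - x)) * (theta p (H) * theta p (y)) =
      (theta p (H + γ + y) * theta p (γ) * (theta p (x - y) * theta p (H - x))) := by
  have h : theta p (H + (y - x)) * theta p (x) * (theta p (y + γ) * theta p (H + γ)) -
      theta p (x + γ) * theta p (H + γ + (y - x)) * (theta p (H) * theta p (y)) =
      theta p (H + γ + y) * theta p (-(γ)) * (theta p (-(x - y)) * theta p (H - x)) := by
    apply theta_rel hp0 hp1 <;> ring
  simp only [theta_neg hp0] at h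
  linear_combination h

theorem theta_rel_height {p : ℝ} (hp0 : 0 < p) (hp1 : p < 1) (H γ : ℂ) :
    theta p (H - γ) * theta p (H + γ) * (theta p (H + γ) * theta p (H + γ)) -
      theta p (H + γ * 2) * theta p (H) * (theta p (H) * theta p (H)) =
      -(theta p (2 * H + γ) * theta p (γ) * (theta p (γ) * theta p (γ))) := by
  have h : theta p (H - γ) * theta p (H + γ) * (theta p (H + γ) * theta p (H + γ)) -
      theta p (H + γ * 2) * theta p (H) * (theta p (H) * theta p (H)) =
      theta p (2 * H + γ) * theta p (-(γ)) * (theta p (-(γ)) * theta p (-(γ))) := by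
    apply theta_rel hp0 hp1 <;> ring
  simp only [theta_neg hp0] at h
  linear_combination h

theorem theta_rel_four {p : ℝ} (hp0 : 0 < p) (hp1 : p < 1) (H γ x y : ℂ) :
    theta p (H + (y - x)) * theta p (H + γ + x) * (theta p (H - y) * theta p (H + γ)) -
      theta p (H + γ + (x - y)) * theta p (H - x) * (theta p (H + γ + y) * theta p (H)) =
      (theta p (2 * H + γ) * theta p (y) * (theta p (x + γ) * theta p (x - y))) := by
  have h : theta p (H + (y - x)) * theta p (H + γ + x) * (theta p (H - y) * theta p (H + γ)) -
      theta p (H + γ + (x - y)) * theta p (H - x) * (theta p (H + γ + y) * theta p (H)) =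
      theta p (2 * H + γ) * theta p (y) * (theta p (-(x + γ)) * theta p (-(x - y))) := by
    apply theta_rel hp0 hp1 <;> ring
  simp only [theta_neg hp0] at h
  linear_combination h

/-- The common neighbours of two heights. -/
def site (f h : ℤ) : Finset ℤ := {f - 1, f + 1} ∩ {h - 1, h + 1}

theorem mem_site {f h a : ℤ} :
    a ∈ site f h ↔ (a = f - 1 ∨ a = f + 1) ∧ (a = h - 1 ∨ a = h + 1) := by
  simp [site]

/-- The Yang–Baxter equation when the lower left height is `0` and the lower right one is `1`. -/
theorem yang_baxter_up {p : ℝ} (hp0 : 0 < p) (hp1 : p < 1) {γ τ : ℂ}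
    (hτ : ∀ k : ℤ, theta p (τ + k * γ) ≠ 0) (x y : ℂ) {h₀ h₁ a b : ℤ}
    (ha : a ∈ site 0 h₀) (hb : b ∈ site 1 h₁) :
    ∑ a' ∈ site 0 h₀, weight p γ τ (x - y) a h₀ 0 a' *
        (weight p γ τ x 0 1 a' b * weight p γ τ y a' b h₀ h₁) =
      ∑ b' ∈ site 1 h₁, weight p γ τ y 0 1 a b' * weight p γ τ x a b' h₀ h₁ *
        weight p γ τ (x - y) b' h₁ 1 b := by
  obtain ⟨H, rfl⟩ : ∃ H, τ = H - γ := ⟨τ + γ, by ring⟩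
  have n0 : theta p (H - γ) ≠ 0 := by simpa using hτ 0
  have n1 : theta p H ≠ 0 := by simpa using hτ 1
  have n2 : theta p (H + γ) ≠ 0 := by convert hτ 2 using 2; push_cast; ring
  have n3 : theta p (H + γ * 2) ≠ 0 := by convert hτ 3 using 2; push_cast; ring
  have e1 : H - γ + 2 * γ = H + γ := by ring
  have e2 : H - γ + 3 * γ = H + γ * 2 := by ring
  have e3 : H + γ + γ = H + γ * 2 := by ring
  have e4 : H + γ + -γ = H := by ring
  have e5 : ∀ z, H + -z = H - z := fun z => by ring
  have e6 : H - γ + γ = H := by ring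
  have s1 : site 0 0 = {-1, 1} := by decide
  have s2 : site 0 2 = {1} := by decide
  have s3 : site 0 (-2) = {-1} := by decide
  have s4 : site 1 1 = {0, 2} := by decide
  have s5 : site 1 3 = {2} := by decide
  have s6 : site 1 (-1) = {0} := by decide
  have d1 : (-1 : ℤ) ≠ 1 := by decide
  have d2 : (0 : ℤ) ≠ 2 := by decide
  have k1 := theta_rel_cross hp0 hp1 H γ x y
  have k2 := theta_rel_turn hp0 hp1 H γ x y
  have k3 := theta_rel_left hp0 hp1 H γ x y
  have k4 := theta_rel_right hp0 hp1 H γ x y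
  have k5 := theta_rel_height hp0 hp1 H γ
  have k6 := theta_rel_four hp0 hp1 H γ x y
  have k7 := theta_rel_cross hp0 hp1 (H + γ) γ x y
  have k8 := theta_rel_left hp0 hp1 (H + γ) γ x y
  rw [show H + γ - γ = H by ring, e3] at k7
  rw [e3] at k8
  obtain ⟨ha0, ha1⟩ := mem_site.1 ha
  obtain ⟨hb0, hb1⟩ := mem_site.1 hb
  have hh0 : h₀ = a - 1 ∨ h₀ = a + 1 := by omega
  have hh1 : h₁ = b - 1 ∨ h₁ = b + 1 := by omega
  clear ha ha1 hb hb1 hτ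
  rcases ha0 with rfl | rfl <;> rcases hh0 with rfl | rfl <;> rcases hb0 with rfl | rfl <;>
    rcases hh1 with rfl | rfl
  all_goals norm_num [s1, s2, s3, s4, s5, s6, Finset.sum_pair d1, Finset.sum_pair d2]
  all_goals norm_num [weight, e1, e2, e3, e4, e5, e6]
  · ring
  · field_simp
    linear_combination (-theta p γ) * k1
  · field_simp
    linear_combination (-theta p γ) * k2
  · field_simp
  · field_simp
    linear_combination (-theta p γ) * k3
  · field_simp
    linear_combination theta p (x - y) * theta p (x + γ) * theta p y * k5 + theta p γ ^ 3 * k6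
  · field_simp
    linear_combination theta p γ * k4
  · field_simp
    linear_combination theta p γ * k7
  · field_simp
    linear_combination theta p γ * k8
  · field_simp

/-- The Yang–Baxter equation. Its two sides are the partition functions of a hexagon cut into
three plaquettes in two ways: `f₀ f₁` below, `h₀ h₁` above, with `a` and `b` in between. -/
theorem yang_baxter {p : ℝ} (hp0 : 0 < p) (hp1 : p < 1) {γ τ : ℂ}
    (hτ : ∀ k : ℤ, theta p (τ + k * γ) ≠ 0) (x y : ℂ) {f₀ f₁ h₀ h₁ a b : ℤ}
    (hf : |f₁ - f₀| = 1) (ha : a ∈ site f₀ h₀) (hb : b ∈ site f₁ h₁) :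
    ∑ a' ∈ site f₀ h₀, weight p γ τ (x - y) a h₀ f₀ a' *
        (weight p γ τ x f₀ f₁ a' b * weight p γ τ y a' b h₀ h₁) =
      ∑ b' ∈ site f₁ h₁, weight p γ τ y f₀ f₁ a b' * weight p γ τ x a b' h₀ h₁ *
        weight p γ τ (x - y) b' h₁ f₁ b := by
  -- the equation is invariant under translating all heights, with a compensating shift of `τ` ...
  have trans : ∀ (τ : ℂ) (k f₀ f₁ h₀ h₁ a b : ℤ),
      (∑ a' ∈ site f₀ h₀, weight p γ (τ + k * γ) (x - y) a h₀ f₀ a' *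
          (weight p γ (τ + k * γ) x f₀ f₁ a' b * weight p γ (τ + k * γ) y a' b h₀ h₁) =
        ∑ b' ∈ site f₁ h₁,
          weight p γ (τ + k * γ) y f₀ f₁ a b' * weight p γ (τ + k * γ) x a b' h₀ h₁ *
            weight p γ (τ + k * γ) (x - y) b' h₁ f₁ b) →
      ∑ a' ∈ site (f₀ + k) (h₀ + k), weight p γ τ (x - y) (a + k) (h₀ + k) (f₀ + k) a' *
          (weight p γ τ x (f₀ + k) (f₁ + k) a' (b + k) *
            weight p γ τ y a' (b + k) (h₀ + k) (h₁ + k)) =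
        ∑ b' ∈ site (f₁ + k) (h₁ + k),
          weight p γ τ y (f₀ + k) (f₁ + k) (a + k) b' *
            weight p γ τ x (a + k) b' (h₀ + k) (h₁ + k) *
            weight p γ τ (x - y) b' (h₁ + k) (f₁ + k) (b + k) := by
    intro τ k f₀ f₁ h₀ h₁ a b h
    have hs : ∀ f h : ℤ, site (f + k) (h + k) = (site f h).map (addRightEmbedding k) := by
      intro f h
      ext z
      simp only [mem_site, Finset.mem_map, addRightEmbedding_apply]
      constructor
      · intro hz
        exact ⟨z - k, by omega, by omega⟩
      · rintro ⟨w, hw, rfl⟩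
        omega
    simp only [hs, Finset.sum_map, addRightEmbedding_apply, weight_shift]
    exact h
  -- ... and under reflecting them, so that `f₀ = 0` and `f₁ = 1` may be assumed
  have refl : ∀ (τ : ℂ) (f₀ f₁ h₀ h₁ a b : ℤ),
      (∑ a' ∈ site (-f₀) (-h₀), weight p γ (-τ - 2 * γ) (x - y) (-a) (-h₀) (-f₀) a' *
          (weight p γ (-τ - 2 * γ) x (-f₀) (-f₁) a' (-b) *
            weight p γ (-τ - 2 * γ) y a' (-b) (-h₀) (-h₁)) =
        ∑ b' ∈ site (-f₁) (-h₁),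
          weight p γ (-τ - 2 * γ) y (-f₀) (-f₁) (-a) b' *
            weight p γ (-τ - 2 * γ) x (-a) b' (-h₀) (-h₁) *
            weight p γ (-τ - 2 * γ) (x - y) b' (-h₁) (-f₁) (-b)) →
      ∑ a' ∈ site f₀ h₀, weight p γ τ (x - y) a h₀ f₀ a' *
          (weight p γ τ x f₀ f₁ a' b * weight p γ τ y a' b h₀ h₁) =
        ∑ b' ∈ site f₁ h₁, weight p γ τ y f₀ f₁ a b' * weight p γ τ x a b' h₀ h₁ *
          weight p γ τ (x - y) b' h₁ f₁ b := by
    intro τ f₀ f₁ h₀ h₁ a b h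
    have hs : ∀ f h : ℤ, site (-f) (-h) = (site f h).map (Equiv.neg ℤ).toEmbedding := by
      intro f h
      ext z
      simp only [mem_site, Finset.mem_map, Equiv.coe_toEmbedding, Equiv.neg_apply]
      constructor
      · intro hz
        exact ⟨-z, by omega, by omega⟩
      · rintro ⟨w, hw, rfl⟩
        omega
    simpa only [hs, Finset.sum_map, Equiv.coe_toEmbedding, Equiv.neg_apply, weight_neg hp0] using h
  have up : ∀ {τ : ℂ} {f₀ f₁ h₀ h₁ a b : ℤ}, (∀ k : ℤ, theta p (τ + k * γ) ≠ 0) →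
      f₁ = f₀ + 1 → a ∈ site f₀ h₀ → b ∈ site f₁ h₁ →
      ∑ a' ∈ site f₀ h₀, weight p γ τ (x - y) a h₀ f₀ a' *
          (weight p γ τ x f₀ f₁ a' b * weight p γ τ y a' b h₀ h₁) =
        ∑ b' ∈ site f₁ h₁, weight p γ τ y f₀ f₁ a b' * weight p γ τ x a b' h₀ h₁ *
          weight p γ τ (x - y) b' h₁ f₁ b := by
    intro τ f₀ f₁ h₀ h₁ a b hτ hf ha hb
    have hτ' : ∀ k : ℤ, theta p (τ + f₀ * γ + k * γ) ≠ 0 := by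
      intro k
      have := hτ (f₀ + k)
      push_cast at this
      rwa [add_mul, ← add_assoc] at this
    have h := trans τ f₀ 0 1 (h₀ - f₀) (h₁ - f₀) (a - f₀) (b - f₀)
      (yang_baxter_up hp0 hp1 hτ' x y (by rw [mem_site] at ha ⊢; omega)
        (by rw [mem_site] at hb ⊢; omega))
    rw [zero_add, show 1 + f₀ = f₁ by omega] at h
    simpa only [sub_add_cancel] using h
  rcases (abs_eq one_pos.le).1 hf with h | h
  · exact up hτ (by omega) ha hb
  · refine refl τ f₀ f₁ h₀ h₁ a b (up ?_ (by omega) ?_ ?_)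
    · intro k
      have e : -τ - 2 * γ + k * γ = -(τ + ((2 - k : ℤ) : ℂ) * γ) := by
        push_cast
        ring
      rw [e, theta_neg hp0]
      exact neg_ne_zero.2 (hτ _)
    · rw [mem_site] at ha ⊢
      omega
    · rw [mem_site] at hb ⊢
      omega

/-! ### The Yang–Baxter equation for rows -/

/-- Sum over all sequences `g` with `g i ∈ A i` and prescribed ends `a`, `b` of the product of the
weights `w i` of the steps: an entry of a product of transfer matrices. -/
def pathSum {N : ℕ} (A : Fin (N + 1) → Finset ℤ) (w : Fin N → ℤ → ℤ → ℂ) (a b : ℤ) : ℂ :=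
  ∑ g ∈ Fintype.piFinset A,
    if g 0 = a ∧ g (Fin.last N) = b then ∏ i : Fin N, w i (g i.castSucc) (g i.succ) else 0

theorem pathSum_zero (A : Fin 1 → Finset ℤ) (w : Fin 0 → ℤ → ℤ → ℂ) {a : ℤ} (ha : a ∈ A 0)
    (b : ℤ) : pathSum A w a b = if a = b then 1 else 0 := by
  rw [pathSum, Finset.sum_eq_single (fun _ => a)]
  · simp
  · intro g _ hg
    rw [if_neg]
    rintro ⟨h, _⟩
    exact hg (funext fun i => by rw [Fin.fin_one_eq_zero i, h])
  · intro h
    exact absurd (Fintype.mem_piFinset.2 fun i => by rwa [Fin.fin_one_eq_zero i]) h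

theorem pathSum_succ {N : ℕ} (A : Fin (N + 2) → Finset ℤ) (w : Fin (N + 1) → ℤ → ℤ → ℂ) {a : ℤ}
    (ha : a ∈ A 0) (b : ℤ) :
    pathSum A w a b =
      ∑ c ∈ A 1, w 0 a c * pathSum (fun i => A i.succ) (fun i => w i.succ) c b := by
  have h1 : ∑ c ∈ A 1, w 0 a c * pathSum (fun i => A i.succ) (fun i => w i.succ) c b =
      ∑ g ∈ Fintype.piFinset (fun i : Fin (N + 1) => A i.succ),
        if g (Fin.last N) = b then
          w 0 a (g 0) * ∏ i : Fin N, w i.succ (g i.castSucc) (g i.succ) else 0 := by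
    simp only [pathSum, Finset.mul_sum]
    rw [Finset.sum_comm]
    refine Finset.sum_congr rfl fun g hg => ?_
    have hg0 : g 0 ∈ A 1 := Fintype.mem_piFinset.1 hg 0
    rw [Finset.sum_eq_single_of_mem (g 0) hg0]
    · simp
    · intro c _ hc
      rw [if_neg (fun h => hc h.1.symm), mul_zero]
  rw [h1, pathSum, ← Finset.sum_filter, ← Finset.sum_filter]
  refine Finset.sum_bij' (fun g _ => Fin.tail g) (fun g _ => Fin.cons a g) ?_ ?_ ?_ ?_ ?_
  · intro g hg
    rw [Finset.mem_filter, Fintype.mem_piFinset] at hg ⊢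
    exact ⟨fun i => hg.1 i.succ, hg.2.2⟩
  · intro g hg
    rw [Finset.mem_filter, Fintype.mem_piFinset] at hg ⊢
    refine ⟨fun i => ?_, rfl, ?_⟩
    · refine Fin.cases ha (fun j => ?_) i
      rw [Fin.cons_succ]
      exact hg.1 j
    · rw [← Fin.succ_last, Fin.cons_succ]
      exact hg.2
  · intro g hg
    rw [Finset.mem_filter] at hg
    rw [← hg.2.1]
    exact Fin.cons_self_tail g
  · intro g _
    exact Fin.tail_cons _ _
  · intro g hg
    rw [Finset.mem_filter] at hg
    rw [Fin.prod_univ_succ, ← hg.2.1]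
    rfl

/-- Local intertwining relations between the steps `w i` and `w' i` multiply up along a path. -/
theorem pathSum_intertwine {N : ℕ} (A : Fin (N + 1) → Finset ℤ) (w w' : Fin N → ℤ → ℤ → ℂ)
    (R : Fin (N + 1) → ℤ → ℤ → ℂ)
    (h : ∀ i : Fin N, ∀ a ∈ A i.castSucc, ∀ b ∈ A i.succ,
      ∑ a' ∈ A i.castSucc, R i.castSucc a a' * w i a' b =
        ∑ b' ∈ A i.succ, w' i a b' * R i.succ b' b)
    {a b : ℤ} (ha : a ∈ A 0) (hb : b ∈ A (Fin.last N)) :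
    ∑ a' ∈ A 0, R 0 a a' * pathSum A w a' b =
      ∑ b' ∈ A (Fin.last N), pathSum A w' a b' * R (Fin.last N) b' b := by
  induction N generalizing a with
  | zero =>
    have hb0 : b ∈ A 0 := hb
    have h1 : ∀ a' ∈ A 0, R 0 a a' * pathSum A w a' b = if a' = b then R 0 a b else 0 := by
      intro a' ha'
      rw [pathSum_zero A w ha', mul_ite, mul_one, mul_zero]
      split_ifs with h <;> simp [h]
    have h2 : ∀ b' ∈ A (Fin.last 0), pathSum A w' a b' * R (Fin.last 0) b' b =
        if a = b' then R 0 a b else 0 := by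
      intro b' _
      rw [pathSum_zero A w' ha, ite_mul, one_mul, zero_mul]
      split_ifs with h <;> simp [h]
    have ha0 : a ∈ A (Fin.last 0) := ha
    rw [Finset.sum_congr rfl h1, Finset.sum_congr rfl h2, Finset.sum_ite_eq', Finset.sum_ite_eq,
      if_pos hb0, if_pos ha0]
  | succ N ih =>
    calc ∑ a' ∈ A 0, R 0 a a' * pathSum A w a' b
        = ∑ c ∈ A 1, (∑ a' ∈ A 0, R 0 a a' * w 0 a' c) *
            pathSum (fun i => A i.succ) (fun i => w i.succ) c b := by
          rw [Finset.sum_congr rfl fun a' ha' => by rw [pathSum_succ A w ha', Finset.mul_sum],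
            Finset.sum_comm]
          refine Finset.sum_congr rfl fun c _ => ?_
          rw [Finset.sum_mul]
          exact Finset.sum_congr rfl fun a' _ => (mul_assoc _ _ _).symm
      _ = ∑ c ∈ A 1, (∑ c' ∈ A 1, w' 0 a c' * R 1 c' c) *
            pathSum (fun i => A i.succ) (fun i => w i.succ) c b :=
          Finset.sum_congr rfl fun c hc => congrArg (· * _) (h 0 a ha c hc)
      _ = ∑ c' ∈ A 1, w' 0 a c' * ∑ c ∈ A 1, R 1 c' c *
            pathSum (fun i => A i.succ) (fun i => w i.succ) c b := by
          simp only [Finset.sum_mul, Finset.mul_sum]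
          rw [Finset.sum_comm]
          simp only [mul_assoc]
      _ = ∑ c' ∈ A 1, w' 0 a c' * ∑ b' ∈ A (Fin.last (N + 1)),
            pathSum (fun i => A i.succ) (fun i => w' i.succ) c' b' *
              R (Fin.last (N + 1)) b' b :=
          Finset.sum_congr rfl fun c' hc' => congrArg (w' 0 a c' * ·)
            (ih (fun i => A i.succ) (fun i => w i.succ) (fun i => w' i.succ)
              (fun i => R i.succ) (fun i => h i.succ) hc' hb)
      _ = ∑ b' ∈ A (Fin.last (N + 1)), pathSum A w' a b' * R (Fin.last (N + 1)) b' b := by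
          simp only [Finset.mul_sum]
          rw [Finset.sum_comm]
          refine Finset.sum_congr rfl fun b' _ => ?_
          rw [pathSum_succ A w' ha, Finset.sum_mul]
          exact Finset.sum_congr rfl fun c' _ => (mul_assoc _ _ _).symm

/-- The sequence of heights along a row: neighbours differ by `±1`. -/
def IsPath {N : ℕ} (f : Fin (N + 1) → ℤ) : Prop :=
  ∀ j : Fin N, |f j.succ - f j.castSucc| = 1

/-- The rows that can lie directly above the row `f`. -/
def neighbors {N : ℕ} (f : Fin (N + 1) → ℤ) : Finset (Fin (N + 1) → ℤ) :=
  Fintype.piFinset fun i => {f i - 1, f i + 1}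

theorem mem_neighbors {N : ℕ} {f g : Fin (N + 1) → ℤ} :
    g ∈ neighbors f ↔ ∀ i, g i = f i - 1 ∨ g i = f i + 1 := by
  simp [neighbors, Fintype.mem_piFinset]

/-- The weight of the row of plaquettes between the rows `f` (below) and `g` (above). -/
def rowWeight {N : ℕ} (p : ℝ) (γ τ : ℂ) (μ : Fin N → ℂ) (x : ℂ) (f g : Fin (N + 1) → ℤ) : ℂ :=
  ∏ j : Fin N, weight p γ τ (x - μ j) (f j.castSucc) (f j.succ) (g j.castSucc) (g j.succ)

/-- The row-to-row transfer operator, acting on functions of the row below, where the height at the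
left end changes by `σ` and the one at the right end by `σ'`. It is an entry of the monodromy
matrix: `σ = -1`, `σ' = 1` for the rows of the domain-wall partition function. -/
def transfer {N : ℕ} (p : ℝ) (γ τ : ℂ) (μ : Fin N → ℂ) (σ σ' : ℤ) (x : ℂ)
    (Φ : (Fin (N + 1) → ℤ) → ℂ) (f : Fin (N + 1) → ℤ) : ℂ :=
  ∑ g ∈ neighbors f, if g 0 = f 0 + σ ∧ g (Fin.last N) = f (Fin.last N) + σ' then
    rowWeight p γ τ μ x f g * Φ g else 0

/-- The partition function of two rows of plaquettes between the rows `f` and `h`, with heights `a`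
and `b` at the ends of the middle row. -/
def twoRow {N : ℕ} (p : ℝ) (γ τ : ℂ) (μ : Fin N → ℂ) (x y : ℂ) (f h : Fin (N + 1) → ℤ)
    (a b : ℤ) : ℂ :=
  pathSum (fun i => site (f i) (h i)) (fun j a b =>
    weight p γ τ (x - μ j) (f j.castSucc) (f j.succ) a b *
      weight p γ τ (y - μ j) a b (h j.castSucc) (h j.succ)) a b

theorem transfer_transfer {N : ℕ} (p : ℝ) (γ τ : ℂ) (μ : Fin N → ℂ) (σ₁ σ₁' σ₂ σ₂' : ℤ) (x y : ℂ)
    (Φ : (Fin (N + 1) → ℤ) → ℂ) (f : Fin (N + 1) → ℤ) :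
    transfer p γ τ μ σ₁ σ₁' x (transfer p γ τ μ σ₂ σ₂' y Φ) f =
      ∑ h ∈ (neighbors f).biUnion neighbors,
        if h 0 = f 0 + (σ₁ + σ₂) ∧ h (Fin.last N) = f (Fin.last N) + (σ₁' + σ₂') then
          twoRow p γ τ μ x y f h (f 0 + σ₁) (f (Fin.last N) + σ₁') * Φ h else 0 := by
  have h1 : ∀ g ∈ neighbors f, (if g 0 = f 0 + σ₁ ∧ g (Fin.last N) = f (Fin.last N) + σ₁' then
      rowWeight p γ τ μ x f g * transfer p γ τ μ σ₂ σ₂' y Φ g else 0) =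
      ∑ h ∈ (neighbors f).biUnion neighbors, if h ∈ neighbors g then
        if h 0 = f 0 + (σ₁ + σ₂) ∧ h (Fin.last N) = f (Fin.last N) + (σ₁' + σ₂') then
          (if g 0 = f 0 + σ₁ ∧ g (Fin.last N) = f (Fin.last N) + σ₁' then
            rowWeight p γ τ μ x f g * rowWeight p γ τ μ y g h else 0) * Φ h else 0 else 0 := by
    intro g hg
    rw [← Finset.sum_filter]
    have e : ((neighbors f).biUnion neighbors).filter (· ∈ neighbors g) = neighbors g := by
      ext h
      simp only [Finset.mem_filter, Finset.mem_biUnion]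
      exact ⟨fun t => t.2, fun t => ⟨⟨g, hg, t⟩, t⟩⟩
    rw [e]
    by_cases hc : g 0 = f 0 + σ₁ ∧ g (Fin.last N) = f (Fin.last N) + σ₁'
    · rw [if_pos hc, transfer, Finset.mul_sum]
      refine Finset.sum_congr rfl fun h _ => ?_
      rw [if_pos hc, hc.1, hc.2, add_assoc, add_assoc, mul_ite, mul_zero, mul_assoc]
    · simp [hc]
  rw [transfer, Finset.sum_congr rfl h1, Finset.sum_comm]
  refine Finset.sum_congr rfl fun h _ => ?_
  rw [← Finset.sum_filter]
  have e : (neighbors f).filter (h ∈ neighbors ·) =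
      Fintype.piFinset fun i => site (f i) (h i) := by
    ext g
    simp only [Finset.mem_filter, mem_neighbors, Fintype.mem_piFinset, mem_site, ← forall_and]
    refine forall_congr' fun i => ?_
    omega
  rw [e]
  by_cases hc : h 0 = f 0 + (σ₁ + σ₂) ∧ h (Fin.last N) = f (Fin.last N) + (σ₁' + σ₂')
  · simp only [if_pos hc, twoRow, pathSum, Finset.sum_mul]
    refine Finset.sum_congr rfl fun g _ => ?_
    simp only [rowWeight, Finset.prod_mul_distrib]
  · simp only [if_neg hc, Finset.sum_const_zero]

theorem twoRow_yang_baxter {N : ℕ} {p : ℝ} (hp0 : 0 < p) (hp1 : p < 1) {γ τ : ℂ}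
    (hτ : ∀ k : ℤ, theta p (τ + k * γ) ≠ 0) (μ : Fin N → ℂ) (x y : ℂ) {f : Fin (N + 1) → ℤ}
    (hf : IsPath f) (h : Fin (N + 1) → ℤ) {a b : ℤ} (ha : a ∈ site (f 0) (h 0))
    (hb : b ∈ site (f (Fin.last N)) (h (Fin.last N))) :
    ∑ a' ∈ site (f 0) (h 0),
        weight p γ τ (x - y) a (h 0) (f 0) a' * twoRow p γ τ μ x y f h a' b =
      ∑ b' ∈ site (f (Fin.last N)) (h (Fin.last N)), twoRow p γ τ μ y x f h a b' *
        weight p γ τ (x - y) b' (h (Fin.last N)) (f (Fin.last N)) b := by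
  refine pathSum_intertwine (fun i => site (f i) (h i)) _ _
    (fun i a b => weight p γ τ (x - y) a (h i) (f i) b) ?_ ha hb
  intro i a ha b hb
  have := yang_baxter hp0 hp1 hτ (x - μ i) (y - μ i) (hf i) ha hb
  rwa [sub_sub_sub_cancel_right] at this

theorem site_add_two (a : ℤ) : site a (a + 2) = {a + 1} := by
  ext z
  rw [mem_site, Finset.mem_singleton]
  omega

theorem site_sub_two (a : ℤ) : site a (a - 2) = {a - 1} := by
  ext z
  rw [mem_site, Finset.mem_singleton]
  omega

theorem site_self (a : ℤ) : site a a = {a - 1, a + 1} := by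
  simp [site]

/-- Exchange relation for two rows of different type at the left end. -/
theorem transfer_exchange {N : ℕ} {p : ℝ} (hp0 : 0 < p) (hp1 : p < 1) {γ τ : ℂ}
    (hτ : ∀ k : ℤ, theta p (τ + k * γ) ≠ 0) (μ : Fin N → ℂ) (x y : ℂ)
    (Φ : (Fin (N + 1) → ℤ) → ℂ) {f : Fin (N + 1) → ℤ} (hf : IsPath f) {H : ℂ}
    (hH : H = τ + ((f 0 : ℂ) + 1) * γ) :
    theta p (H + γ) * theta p (x - y) *
        transfer p γ τ μ 1 1 x (transfer p γ τ μ (-1) 1 y Φ) f +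
      theta p (H + (x - y)) * theta p γ *
        transfer p γ τ μ (-1) 1 x (transfer p γ τ μ 1 1 y Φ) f =
      theta p (x - y + γ) * theta p H *
        transfer p γ τ μ (-1) 1 y (transfer p γ τ μ 1 1 x Φ) f := by
  have hH0 : theta p H ≠ 0 := by
    rw [hH]
    exact_mod_cast hτ (f 0 + 1)
  simp only [transfer_transfer, Finset.mul_sum, ← Finset.sum_add_distrib]
  refine Finset.sum_congr rfl fun h _ => ?_
  norm_num only [add_zero]
  by_cases hc : h 0 = f 0 ∧ h (Fin.last N) = f (Fin.last N) + 2
  · simp only [if_pos hc]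
    have key := twoRow_yang_baxter hp0 hp1 hτ μ x y hf h (a := f 0 - 1)
      (b := f (Fin.last N) + 1) (by rw [mem_site]; omega) (by rw [mem_site]; omega)
    rw [hc.1, hc.2, site_self, site_add_two, Finset.sum_singleton,
      Finset.sum_pair (by omega)] at key
    have w1 : weight p γ τ (x - y) (f 0 - 1) (f 0) (f 0) (f 0 - 1) =
        theta p (H + (x - y)) * theta p γ / theta p H := by
      simp [weight, hH]
    have w2 : weight p γ τ (x - y) (f 0 - 1) (f 0) (f 0) (f 0 + 1) =
        theta p (H + γ) * theta p (x - y) / theta p H := by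
      have : f 0 - 1 ≠ f 0 + 1 := by omega
      simp [weight, hH, this]
    have w3 : weight p γ τ (x - y) (f (Fin.last N) + 1) (f (Fin.last N) + 2) (f (Fin.last N))
        (f (Fin.last N) + 1) = theta p (x - y + γ) := by
      simp [weight]
    rw [w1, w2, w3] at key
    field_simp at key
    rw [← sub_eq_add_neg]
    linear_combination Φ h * key
  · simp only [if_neg hc, mul_zero, add_zero]

/-- Two rows of domain-wall type commute, up to a factor that is removed below by continuity. -/
theorem transfer_comm_mul {N : ℕ} {p : ℝ} (hp0 : 0 < p) (hp1 : p < 1) {γ τ : ℂ}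
    (hτ : ∀ k : ℤ, theta p (τ + k * γ) ≠ 0) (μ : Fin N → ℂ) (x y : ℂ)
    (Φ : (Fin (N + 1) → ℤ) → ℂ) {f : Fin (N + 1) → ℤ} (hf : IsPath f) :
    theta p (x - y + γ) * transfer p γ τ μ (-1) 1 x (transfer p γ τ μ (-1) 1 y Φ) f =
      theta p (x - y + γ) * transfer p γ τ μ (-1) 1 y (transfer p γ τ μ (-1) 1 x Φ) f := by
  simp only [transfer_transfer, Finset.mul_sum]
  refine Finset.sum_congr rfl fun h _ => ?_
  norm_num only
  by_cases hc : h 0 = f 0 + -2 ∧ h (Fin.last N) = f (Fin.last N) + 2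
  · simp only [if_pos hc]
    rw [← sub_eq_add_neg] at hc
    have key := twoRow_yang_baxter hp0 hp1 hτ μ x y hf h (a := f 0 - 1)
      (b := f (Fin.last N) + 1) (by rw [mem_site]; omega) (by rw [mem_site]; omega)
    rw [hc.1, hc.2, site_sub_two, site_add_two, Finset.sum_singleton,
      Finset.sum_singleton] at key
    have w1 : weight p γ τ (x - y) (f 0 - 1) (f 0 - 2) (f 0) (f 0 - 1) = theta p (x - y + γ) := by
      have : f 0 ≠ f 0 - 2 := by omega
      simp [weight, this]
    have w3 : weight p γ τ (x - y) (f (Fin.last N) + 1) (f (Fin.last N) + 2) (f (Fin.last N))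
        (f (Fin.last N) + 1) = theta p (x - y + γ) := by
      simp [weight]
    rw [w1, w3] at key
    rw [← sub_eq_add_neg]
    linear_combination Φ h * key
  · simp only [if_neg hc]

theorem continuous_weight {p : ℝ} (hp0 : 0 < p) (hp1 : p < 1) (γ τ : ℂ) (a b c d : ℤ) :
    Continuous fun u => weight p γ τ u a b c d := by
  have := continuous_theta hp0 hp1
  unfold weight
  simp only
  split_ifs <;> fun_prop

theorem continuous_transfer {N : ℕ} {p : ℝ} (hp0 : 0 < p) (hp1 : p < 1) (γ τ : ℂ) (μ : Fin N → ℂ)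
    (σ σ' : ℤ) {x : ℂ → ℂ} (hx : Continuous x) {Φ : ℂ → (Fin (N + 1) → ℤ) → ℂ}
    (hΦ : ∀ f, Continuous fun t => Φ t f) (f : Fin (N + 1) → ℤ) :
    Continuous fun t => transfer p γ τ μ σ σ' (x t) (Φ t) f := by
  unfold transfer
  refine continuous_finsetSum _ fun g _ => ?_
  split_ifs
  · refine Continuous.mul (continuous_finsetProd _ fun j _ => ?_) (hΦ g)
    exact (continuous_weight hp0 hp1 γ τ _ _ _ _).comp (hx.sub continuous_const)
  · exact continuous_const

/-- Rows of domain-wall type commute. -/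
theorem transfer_comm {N : ℕ} {p : ℝ} (hp0 : 0 < p) (hp1 : p < 1) {γ τ : ℂ}
    (hτ : ∀ k : ℤ, theta p (τ + k * γ) ≠ 0) (μ : Fin N → ℂ) (x y : ℂ)
    (Φ : (Fin (N + 1) → ℤ) → ℂ) {f : Fin (N + 1) → ℤ} (hf : IsPath f) :
    transfer p γ τ μ (-1) 1 x (transfer p γ τ μ (-1) 1 y Φ) f =
      transfer p γ τ μ (-1) 1 y (transfer p γ τ μ (-1) 1 x Φ) f := by
  -- the factor `[x - y + γ]` vanishes only on a set of `x` with empty interior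
  have h1 := continuous_transfer hp0 hp1 γ τ μ (-1) 1 continuous_id
    (Φ := fun _ => transfer p γ τ μ (-1) 1 y Φ) (fun _ => continuous_const) f
  have h2 := continuous_transfer hp0 hp1 γ τ μ (-1) 1 (continuous_const (y := y))
    (Φ := fun t => transfer p γ τ μ (-1) 1 t Φ) (fun g =>
      continuous_transfer hp0 hp1 γ τ μ (-1) 1 continuous_id (Φ := fun _ => Φ)
        (fun _ => continuous_const) g) f
  refine congrFun (Continuous.ext_on (dense_theta_ne_zero hp0 hp1 (hτ 0) (-y + γ)) h1 h2 ?_) x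
  intro z hz
  have hz' : theta p (z - y + γ) ≠ 0 := by
    rwa [Set.mem_ofPred_eq, ← add_assoc, ← sub_eq_add_neg] at hz
  exact mul_left_cancel₀ hz' (transfer_comm_mul hp0 hp1 hτ μ z y Φ hf)

/-! ### Moving a row through a stack of rows -/

/-- A stack of rows of domain-wall type, the head of the list being the lowest row. -/
def stack {N : ℕ} (p : ℝ) (γ τ : ℂ) (μ : Fin N → ℂ) (xs : List ℂ)
    (Φ : (Fin (N + 1) → ℤ) → ℂ) : (Fin (N + 1) → ℤ) → ℂ :=
  xs.foldr (transfer p γ τ μ (-1) 1) Φ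

theorem stack_cons {N : ℕ} (p : ℝ) (γ τ : ℂ) (μ : Fin N → ℂ) (x : ℂ) (xs : List ℂ)
    (Φ : (Fin (N + 1) → ℤ) → ℂ) :
    stack p γ τ μ (x :: xs) Φ = transfer p γ τ μ (-1) 1 x (stack p γ τ μ xs Φ) :=
  rfl

theorem isPath_of_rowWeight_ne_zero {N : ℕ} {p : ℝ} {γ τ : ℂ} {μ : Fin N → ℂ} {x : ℂ}
    {f g : Fin (N + 1) → ℤ} (hf : IsPath f) (hg : g ∈ neighbors f)
    (h : rowWeight p γ τ μ x f g ≠ 0) : IsPath g := by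
  intro j
  have hw := Finset.prod_ne_zero_iff.1 h j (Finset.mem_univ j)
  have h1 := mem_neighbors.1 hg j.succ
  have h2 := mem_neighbors.1 hg j.castSucc
  have h3 := (abs_eq one_pos.le).1 (hf j)
  rw [abs_eq one_pos.le]
  by_contra hcon
  apply hw
  have e1 : ¬ (g j.castSucc ≠ f j.succ ∧ f j.castSucc = g j.succ) := by omega
  have e2 : ¬ g j.castSucc = f j.succ := by omega
  simp only [weight, if_neg e1, e2, false_and, if_false]

theorem transfer_congr {N : ℕ} {p : ℝ} {γ τ : ℂ} {μ : Fin N → ℂ} {σ σ' : ℤ} {x : ℂ}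
    {Φ Ψ : (Fin (N + 1) → ℤ) → ℂ} {f : Fin (N + 1) → ℤ} (hf : IsPath f)
    (h : ∀ g, IsPath g → g 0 = f 0 + σ → Φ g = Ψ g) :
    transfer p γ τ μ σ σ' x Φ f = transfer p γ τ μ σ σ' x Ψ f := by
  refine Finset.sum_congr rfl fun g hg => ?_
  split_ifs with hc
  · by_cases hw : rowWeight p γ τ μ x f g = 0
    · rw [hw, zero_mul, zero_mul]
    · rw [h g (isPath_of_rowWeight_ne_zero hf hg hw) hc.1]
  · rfl

theorem transfer_add_sum {N m : ℕ} (p : ℝ) (γ τ : ℂ) (μ : Fin N → ℂ) (σ σ' : ℤ) (x a : ℂ)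
    (c : Fin m → ℂ) (Φ : (Fin (N + 1) → ℤ) → ℂ) (Ψ : Fin m → (Fin (N + 1) → ℤ) → ℂ)
    (f : Fin (N + 1) → ℤ) :
    transfer p γ τ μ σ σ' x (fun g => a * Φ g + ∑ i, c i * Ψ i g) f =
      a * transfer p γ τ μ σ σ' x Φ f + ∑ i, c i * transfer p γ τ μ σ σ' x (Ψ i) f := by
  simp only [transfer, Finset.mul_sum]
  rw [Finset.sum_comm, ← Finset.sum_add_distrib]
  refine Finset.sum_congr rfl fun g _ => ?_
  split_ifs
  · rw [mul_add, Finset.mul_sum]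
    congr 1
    · ring
    · exact Finset.sum_congr rfl fun i _ => by ring
  · simp

theorem stack_perm {N : ℕ} {p : ℝ} (hp0 : 0 < p) (hp1 : p < 1) {γ τ : ℂ}
    (hτ : ∀ k : ℤ, theta p (τ + k * γ) ≠ 0) (μ : Fin N → ℂ) {xs ys : List ℂ} (h : xs.Perm ys)
    (Φ : (Fin (N + 1) → ℤ) → ℂ) {f : Fin (N + 1) → ℤ} (hf : IsPath f) :
    stack p γ τ μ xs Φ f = stack p γ τ μ ys Φ f := by
  induction h generalizing f with
  | nil => rfl
  | cons x _ ih => exact transfer_congr hf fun g hg _ => ih hg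
  | swap x y l => exact transfer_comm hp0 hp1 hτ μ y x _ hf
  | trans _ _ ih1 ih2 => exact (ih1 hf).trans (ih2 hf)

theorem stack_cons_update_comm {N m : ℕ} {p : ℝ} (hp0 : 0 < p) (hp1 : p < 1) {γ τ : ℂ}
    (hτ : ∀ k : ℤ, theta p (τ + k * γ) ≠ 0) (μ : Fin N → ℂ) (t : Fin m → ℂ) (i : Fin m) (y z : ℂ)
    (Φ : (Fin (N + 1) → ℤ) → ℂ) {f : Fin (N + 1) → ℤ} (hf : IsPath f) :
    stack p γ τ μ (z :: List.ofFn (Function.update t i y)) Φ f =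
      stack p γ τ μ (y :: List.ofFn (Function.update t i z)) Φ f := by
  refine stack_perm hp0 hp1 hτ μ ?_ Φ hf
  have h : ∀ (a : ℂ) (s : Fin m → ℂ),
      a :: List.ofFn s = List.ofFn (Fin.cons a s : Fin (m + 1) → ℂ) := by
    intro a s
    simp [List.ofFn_succ]
  have e : (Fin.cons z (Function.update t i y) : Fin (m + 1) → ℂ) =
      (Fin.cons y (Function.update t i z) : Fin (m + 1) → ℂ) ∘ Equiv.swap 0 i.succ := by
    funext j
    refine Fin.cases ?_ (fun j => ?_) j
    · simp
    · by_cases hj : j = i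
      · subst hj
        simp [(Fin.succ_ne_zero j).symm]
      · have h1 : j.succ ≠ i.succ := fun t => hj (Fin.succ_injective _ t)
        simp [Equiv.swap_apply_of_ne_of_ne (Fin.succ_ne_zero j) h1, hj]
  rw [h, h, e]
  exact Equiv.Perm.ofFn_comp_perm _ _

/-- The factor `[v + γ] / [v]` that a row picks up when it passes another one. -/
def passing (p : ℝ) (γ v : ℂ) : ℂ := theta p (v + γ) / theta p v

theorem prod_erase_zero {m : ℕ} (g : Fin (m + 1) → ℂ) :
    ∏ j ∈ Finset.univ.erase 0, g j = ∏ j : Fin m, g j.succ := by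
  rw [← Finset.filter_ne', Finset.prod_filter, Fin.prod_univ_succ]
  simp

theorem prod_erase_succ {m : ℕ} (g : Fin (m + 1) → ℂ) (i : Fin m) :
    ∏ j ∈ Finset.univ.erase i.succ, g j = g 0 * ∏ j ∈ Finset.univ.erase i, g j.succ := by
  rw [← Finset.filter_ne', ← Finset.filter_ne', Finset.prod_filter, Finset.prod_filter,
    Fin.prod_univ_succ]
  simp [(Fin.succ_ne_zero i).symm]

/-- The identity behind the induction step of `transfer_stack`. -/
theorem theta_rel_step {p : ℝ} (hp0 : 0 < p) (hp1 : p < 1) (H γ x y z : ℂ) :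
    theta p (z - y + γ) * theta p H * (theta p (H - γ + (z - x)) * theta p (y - x)) -
        theta p (y - x + (H - γ)) * theta p (z - x) * (theta p γ * theta p (H + (z - y))) =
      theta p (H + (z - x)) * theta p (x - y + γ) * (-theta p (z - y) * theta p (H - γ)) := by
  have h : theta p (z - y + γ) * theta p H * (theta p (H - γ + (z - x)) * theta p (y - x)) -
        theta p (y - x + (H - γ)) * theta p (z - x) * (theta p γ * theta p (H + (z - y))) =
      theta p (H + (z - x)) * theta p (x - y + γ) * (theta p (z - y) * theta p (-(H - γ))) := by
    apply theta_rel hp0 hp1 <;> ring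
  rw [theta_neg hp0] at h
  linear_combination h

/-- Moving a row with spectral parameter `z` through a stack, from below to above: either it
passes, or it exchanges its spectral parameter with one of the rows of the stack. The prefactors
`[H + γ]` and `[H + γ - m γ]` are what is left of a telescoping product over the left heights. -/
theorem transfer_stack {N m : ℕ} {p : ℝ} (hp0 : 0 < p) (hp1 : p < 1) {γ τ : ℂ}
    (hτ : ∀ k : ℤ, theta p (τ + k * γ) ≠ 0) (μ : Fin N → ℂ) (x : Fin m → ℂ) (z : ℂ)
    (hx : ∀ i j, i ≠ j → theta p (x i - x j) ≠ 0) (hz : ∀ j, theta p (z - x j) ≠ 0)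
    (Φ : (Fin (N + 1) → ℤ) → ℂ) {f : Fin (N + 1) → ℤ} (hf : IsPath f) {H : ℂ}
    (hH : H = τ + ((f 0 : ℂ) + 1) * γ) :
    theta p (H + γ) * transfer p γ τ μ 1 1 z (stack p γ τ μ (List.ofFn x) Φ) f =
      theta p (H + γ - m * γ) * ((∏ j, passing p γ (z - x j)) *
        stack p γ τ μ (List.ofFn x) (transfer p γ τ μ 1 1 z Φ) f -
      ∑ i, theta p γ * theta p (H + (z - x i)) / (theta p H * theta p (z - x i)) *
        (∏ j ∈ Finset.univ.erase i, passing p γ (x i - x j)) *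
        stack p γ τ μ (List.ofFn (Function.update x i z)) (transfer p γ τ μ 1 1 (x i) Φ) f) := by
  induction m generalizing z f H with
  | zero => simp [stack]
  | succ m ih =>
    obtain ⟨y, t, rfl⟩ : ∃ y t, x = Fin.cons y t := ⟨x 0, Fin.tail x, (Fin.cons_self_tail x).symm⟩
    have hH0 : theta p H ≠ 0 := by
      rw [hH]
      exact_mod_cast hτ (f 0 + 1)
    have hH1 : theta p (H - γ) ≠ 0 := by
      have e : H - γ = τ + (f 0 : ℂ) * γ := by rw [hH]; ring
      rw [e]
      exact hτ (f 0)
    have hzy : theta p (z - y) ≠ 0 := hz 0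
    have hzt : ∀ j, theta p (z - t j) ≠ 0 := fun j => hz j.succ
    have hyt : ∀ j, theta p (y - t j) ≠ 0 := fun j => hx 0 j.succ (Fin.succ_ne_zero j).symm
    have htt : ∀ i j, i ≠ j → theta p (t i - t j) ≠ 0 := fun i j h =>
      hx i.succ j.succ fun e => h (Fin.succ_injective _ e)
    -- the induction hypothesis, below an additional row
    have step : ∀ v w, (∀ j, theta p (w - t j) ≠ 0) →
        transfer p γ τ μ (-1) 1 v
            (transfer p γ τ μ 1 1 w (stack p γ τ μ (List.ofFn t) Φ)) f =
          theta p (H - m * γ) / theta p H * (∏ j, passing p γ (w - t j)) *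
            stack p γ τ μ (v :: List.ofFn t) (transfer p γ τ μ 1 1 w Φ) f +
          ∑ i, -(theta p (H - m * γ) / theta p H *
              (theta p γ * theta p (H - γ + (w - t i)) / (theta p (H - γ) * theta p (w - t i)) *
                ∏ j ∈ Finset.univ.erase i, passing p γ (t i - t j))) *
            stack p γ τ μ (v :: List.ofFn (Function.update t i w))
              (transfer p γ τ μ 1 1 (t i) Φ) f := by
      intro v w hw
      simp only [stack_cons]
      rw [← transfer_add_sum]
      refine transfer_congr hf fun g hg hg0 => ?_
      have h := ih t w htt hw hg (H := H - γ) (by rw [hH, hg0]; push_cast; ring)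
      rw [sub_add_cancel] at h
      rw [← mul_right_inj' hH0, h, mul_sub, mul_add, Finset.mul_sum, Finset.mul_sum, sub_eq_add_neg,
        ← Finset.sum_neg_distrib]
      congr 1
      · field_simp
      · refine Finset.sum_congr rfl fun i _ => ?_
        generalize theta p γ * theta p (H - γ + (w - t i)) /
          (theta p (H - γ) * theta p (w - t i)) = c
        field_simp
    have exch := transfer_exchange hp0 hp1 hτ μ z y (stack p γ τ μ (List.ofFn t) Φ) hf hH
    rw [step z y hyt, step y z hzt] at exch
    have hc : H + γ - ((m + 1 : ℕ) : ℂ) * γ = H - m * γ := by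
      push_cast
      ring
    rw [hc, Fin.sum_univ_succ, Fin.prod_univ_succ, prod_erase_zero]
    simp only [prod_erase_succ, Fin.cons_zero, Fin.cons_succ, Fin.update_cons_zero,
      ← Fin.cons_update, List.ofFn_cons]
    set S : Fin m → ℂ := fun i => stack p γ τ μ (y :: List.ofFn (Function.update t i z))
      (transfer p γ τ μ 1 1 (t i) Φ) f with hS
    set E : Fin m → ℂ := fun i => ∏ j ∈ Finset.univ.erase i, passing p γ (t i - t j) with hE
    have perm : ∀ i, stack p γ τ μ (z :: List.ofFn (Function.update t i y))
        (transfer p γ τ μ 1 1 (t i) Φ) f = S i := fun i =>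
      stack_cons_update_comm hp0 hp1 hτ μ t i y z _ hf
    simp only [perm] at exch
    -- `z` is exchanged with `t i` either directly, after passing `y`, or with `y` as intermediary
    have hsum : theta p (z - y + γ) * theta p H *
          ∑ i, -(theta p (H - m * γ) / theta p H *
            (theta p γ * theta p (H - γ + (z - t i)) / (theta p (H - γ) * theta p (z - t i)) *
              E i)) * S i -
        theta p (H + (z - y)) * theta p γ *
          ∑ i, -(theta p (H - m * γ) / theta p H *
            (theta p γ * theta p (H - γ + (y - t i)) / (theta p (H - γ) * theta p (y - t i)) *
              E i)) * S i =
        -(theta p (z - y) * theta p (H - m * γ) *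
          ∑ i, theta p γ * theta p (H + (z - t i)) / (theta p H * theta p (z - t i)) *
            (passing p γ (t i - y) * E i) * S i) := by
      simp only [Finset.mul_sum]
      rw [← Finset.sum_sub_distrib, ← Finset.sum_neg_distrib]
      refine Finset.sum_congr rfl fun i _ => ?_
      have h1 := hzt i
      have h2 := hyt i
      have h3 := theta_rel_step hp0 hp1 H γ (t i) y z
      have h4 : theta p (t i - y) = -theta p (y - t i) := by rw [← theta_neg hp0, neg_sub]
      have h5 : y - t i + (H - γ) = H - γ + (y - t i) := by ring
      rw [h5] at h3
      rw [passing, h4]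
      generalize theta p (H - γ + (z - t i)) = a1 at *
      generalize theta p (H - γ + (y - t i)) = a2 at *
      generalize theta p (H + (z - t i)) = a3 at *
      generalize theta p (H + (z - y)) = a4 at *
      generalize theta p (t i - y + γ) = a5 at *
      generalize theta p (z - y + γ) = a6 at *
      generalize theta p (z - t i) = a7 at *
      generalize theta p (y - t i) = a8 at *
      generalize theta p (H - γ) = a9 at *
      generalize theta p (H - m * γ) = a10 at *
      field_simp
      linear_combination (-(a10 * theta p γ * E i * S i)) * h3
    have ht : passing p γ (z - y) * theta p (z - y) = theta p (z - y + γ) :=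
      div_mul_cancel₀ _ hzy
    rw [← mul_right_inj' hzy]
    generalize hP : ∏ j, passing p γ (z - t j) = P1 at *
    generalize hQ : ∏ j, passing p γ (y - t j) = Q1 at *
    have hdiv : theta p (z - y) * (theta p γ * theta p (H + (z - y)) /
        (theta p H * theta p (z - y))) = theta p γ * theta p (H + (z - y)) / theta p H := by
      field_simp
    have hmul : theta p H * (theta p (H - m * γ) / theta p H) = theta p (H - m * γ) :=
      mul_div_cancel₀ _ hH0
    simp only [hS, hE] at exch hsum
    simp only [← stack_cons] at exch
    linear_combination exch + hsum -
      theta p (H - m * γ) * P1 *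
        stack p γ τ μ (y :: List.ofFn t) (transfer p γ τ μ 1 1 z Φ) f * ht +
      theta p (H - m * γ) * Q1 *
        stack p γ τ μ (z :: List.ofFn t) (transfer p γ τ μ 1 1 y Φ) f * hdiv +
      theta p (z - y + γ) * P1 *
        stack p γ τ μ (y :: List.ofFn t) (transfer p γ τ μ 1 1 z Φ) f * hmul

/-! ### The partition function as a stack of rows -/

/-- Prefixing a sequence of rows with the row `f`. -/
def consRow {N : ℕ} (m : ℕ) (f : Fin (N + 1) → ℤ) :
    (Fin (m + 1) → Fin (N + 1) → ℤ) ↪ (Fin (m + 2) → Fin (N + 1) → ℤ) where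
  toFun n := Fin.cons f n
  inj' := Fin.cons_right_injective (α := fun _ => Fin (N + 1) → ℤ) f

theorem consRow_apply {N m : ℕ} (f : Fin (N + 1) → ℤ) (n : Fin (m + 1) → Fin (N + 1) → ℤ) :
    consRow m f n = Fin.cons f n :=
  rfl

/-- All sequences of rows starting at `f` and ending at `g` in which, from each row to the next,
all heights change by `±1`, the left end drops by one and the right end rises by one. -/
def rowSequences {N : ℕ} : (m : ℕ) → (f g : Fin (N + 1) → ℤ) →
    Finset (Fin (m + 1) → Fin (N + 1) → ℤ)
  | 0, f, g => if f = g then {fun _ => f} else ∅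
  | m + 1, f, g =>
    ((neighbors f).filter fun f' =>
      f' 0 = f 0 + -1 ∧ f' (Fin.last N) = f (Fin.last N) + 1).biUnion fun f' =>
        (rowSequences m f' g).map (consRow m f)

theorem mem_rowSequences {N m : ℕ} {f g : Fin (N + 1) → ℤ} {n : Fin (m + 1) → Fin (N + 1) → ℤ} :
    n ∈ rowSequences m f g ↔ n 0 = f ∧ n (Fin.last m) = g ∧ ∀ i : Fin m,
      n i.succ ∈ neighbors (n i.castSucc) ∧ n i.succ 0 = n i.castSucc 0 + -1 ∧
        n i.succ (Fin.last N) = n i.castSucc (Fin.last N) + 1 := by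
  induction m generalizing f with
  | zero =>
    rw [rowSequences]
    split_ifs with h
    · subst h
      rw [Finset.mem_singleton]
      constructor
      · rintro rfl
        exact ⟨rfl, rfl, fun i => i.elim0⟩
      · rintro ⟨h, -, -⟩
        funext i
        rw [Fin.fin_one_eq_zero i, h]
    · simp only [Finset.notMem_empty, false_iff]
      rintro ⟨h1, h2, -⟩
      exact h (h1.symm.trans h2)
  | succ m ih =>
    simp only [rowSequences, Finset.mem_biUnion, Finset.mem_filter, Finset.mem_map,
      consRow_apply]
    constructor
    · rintro ⟨f', ⟨h1, h2⟩, n, hn, rfl⟩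
      obtain ⟨h3, h4, h5⟩ := ih.1 hn
      refine ⟨rfl, by rw [← Fin.succ_last, Fin.cons_succ, h4], fun i => ?_⟩
      refine Fin.cases ?_ (fun i => ?_) i
      · rw [Fin.cons_succ, Fin.castSucc_zero, Fin.cons_zero, h3]
        exact ⟨h1, h2⟩
      · rw [Fin.cons_succ, ← Fin.succ_castSucc, Fin.cons_succ]
        exact h5 i
    · rintro ⟨rfl, h2, h3⟩
      exact ⟨n 1, h3 0, Fin.tail n, ih.2 ⟨rfl, h2, fun i => h3 i.succ⟩, Fin.cons_self_tail n⟩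

theorem stack_eq_sum {N m : ℕ} (p : ℝ) (γ τ : ℂ) (μ : Fin N → ℂ) (x : Fin m → ℂ)
    (f g : Fin (N + 1) → ℤ) :
    stack p γ τ μ (List.ofFn x) (Pi.single g 1) f =
      ∑ n ∈ rowSequences m f g,
        ∏ i : Fin m, rowWeight p γ τ μ (x i) (n i.castSucc) (n i.succ) := by
  induction m generalizing f with
  | zero =>
    rw [rowSequences]
    split_ifs with h
    · simp [stack, h]
    · simp [stack, h]
  | succ m ih =>
    rw [rowSequences, Finset.sum_biUnion, List.ofFn_succ, stack_cons, transfer, Finset.sum_filter]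
    · refine Finset.sum_congr rfl fun f' _ => ?_
      congr 1
      rw [Finset.sum_map, ih, Finset.mul_sum]
      refine Finset.sum_congr rfl fun n hn => ?_
      rw [Fin.prod_univ_succ, consRow_apply]
      simp only [Fin.cons_succ, Fin.castSucc_zero, Fin.cons_zero, ← Fin.succ_castSucc]
      rw [(mem_rowSequences.1 hn).1]
    · intro f₁ _ f₂ _ hne
      rw [Function.onFun, Finset.disjoint_left]
      intro n h1 h2
      rw [Finset.mem_map] at h1 h2
      obtain ⟨n₁, hn₁, rfl⟩ := h1
      obtain ⟨n₂, hn₂, e⟩ := h2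
      have e' : n₂ = n₁ := (consRow m f).injective e
      rw [e'] at hn₂
      exact hne ((mem_rowSequences.1 hn₁).1.symm.trans (mem_rowSequences.1 hn₂).1)

/-- Along a row the heights change by at most one per step, measured from either end. -/
theorem IsPath.bounds {N : ℕ} {f : Fin (N + 1) → ℤ} (hf : IsPath f) (j : Fin (N + 1)) :
    (f j - j ≤ f 0 ∧ f (Fin.last N) - N ≤ f j - j) ∧
      (f 0 ≤ f j + j ∧ f j + j ≤ f (Fin.last N) + N) := by
  have h1 : Antitone fun j : Fin (N + 1) => f j - j := by
    rw [Fin.antitone_iff_succ_le]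
    intro i
    have := abs_le.1 (hf i).le
    simp only [Fin.val_succ, Fin.val_castSucc]
    push_cast
    omega
  have h2 : Monotone fun j : Fin (N + 1) => f j + j := by
    rw [Fin.monotone_iff_le_succ]
    intro i
    have := abs_le.1 (hf i).le
    simp only [Fin.val_succ, Fin.val_castSucc]
    push_cast
    omega
  have a1 := h1 (Fin.zero_le j)
  have a2 := h1 (Fin.le_last j)
  have a3 := h2 (Fin.zero_le j)
  have a4 := h2 (Fin.le_last j)
  simp only [Fin.val_zero, Fin.val_last] at a1 a2 a3 a4
  omega

/-- The row `N + k, …, k`. -/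
def descending (N : ℕ) (k : ℤ) : Fin (N + 1) → ℤ := fun j => N - j + k

/-- The row `k, …, N + k`. -/
def ascending (N : ℕ) (k : ℤ) : Fin (N + 1) → ℤ := fun j => j + k

theorem isPath_descending (N : ℕ) (k : ℤ) : IsPath (descending N k) := by
  intro j
  rw [abs_eq one_pos.le]
  simp only [descending, Fin.val_succ, Fin.val_castSucc]
  push_cast
  omega

theorem IsPath.eq_descending {N : ℕ} {f : Fin (N + 1) → ℤ} (hf : IsPath f) {k : ℤ}
    (h0 : f 0 = N + k) (h1 : f (Fin.last N) = k) : f = descending N k := by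
  funext j
  have := hf.bounds j
  simp only [descending]
  omega

theorem IsPath.eq_ascending {N : ℕ} {f : Fin (N + 1) → ℤ} (hf : IsPath f) {k : ℤ}
    (h0 : f 0 = k) (h1 : f (Fin.last N) = N + k) : f = ascending N k := by
  funext j
  have := hf.bounds j
  simp only [ascending]
  omega

theorem Z_eq_stack {L : ℕ} (p : ℝ) (γ τ : ℂ) (μ x : Fin L → ℂ) :
    Z p γ τ μ x =
      stack p γ τ μ (List.ofFn x) (Pi.single (ascending L 0) 1) (descending L 0) := by
  rw [stack_eq_sum, Z]
  refine Finset.sum_subset ?_ ?_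
  · intro n hn
    have hn' : IsConfig L n := by simpa using hn
    refine mem_rowSequences.2 ⟨?_, ?_, fun i => ⟨?_, ?_, ?_⟩⟩
    · funext j
      simp [hn'.first_row, descending]
    · funext j
      simp [hn'.last_row, ascending]
    · refine mem_neighbors.2 fun j => ?_
      have := (abs_eq one_pos.le).1 (hn'.vert i j)
      omega
    · rw [hn'.first_col, hn'.first_col, Fin.val_succ, Fin.val_castSucc]
      push_cast
      ring
    · rw [hn'.last_col, hn'.last_col, Fin.val_succ, Fin.val_castSucc]
      push_cast
      ring
  · intro n hn hn'
    by_contra hprod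
    apply hn'
    obtain ⟨h1, h2, h3⟩ := mem_rowSequences.1 hn
    have hw := fun i => Finset.prod_ne_zero_iff.1 hprod i (Finset.mem_univ i)
    have hpath : ∀ i, IsPath (n i) := by
      intro i
      induction i using Fin.induction with
      | zero => exact h1 ▸ isPath_descending L 0
      | succ i ih => exact isPath_of_rowWeight_ne_zero ih (h3 i).1 (hw i)
    have hcol : ∀ i, n i 0 = (L : ℤ) - (i : ℤ) ∧ n i (Fin.last L) = (i : ℤ) := by
      intro i
      induction i using Fin.induction with
      | zero => simp [h1, descending]
      | succ i ih =>
        rw [(h3 i).2.1, (h3 i).2.2, ih.1, ih.2, Fin.val_succ, Fin.val_castSucc]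
        push_cast
        omega
    rw [Set.Finite.mem_toFinset]
    exact
      { vert := fun i j => by
          have := mem_neighbors.1 (h3 i).1 j
          rw [abs_eq one_pos.le]
          omega
        horiz := fun i j => hpath i j
        first_row := fun j => by simp [h1, descending]
        first_col := fun i => (hcol i).1
        last_row := fun j => by simp [h2, ascending]
        last_col := fun i => (hcol i).2 }

/-! ### The row of opposite type below and above the stack -/

theorem stack_congr_mul {N : ℕ} {p : ℝ} {γ τ : ℂ} {μ : Fin N → ℂ} {xs : List ℂ} (c : ℂ)
    {Φ Ψ : (Fin (N + 1) → ℤ) → ℂ} {f : Fin (N + 1) → ℤ} (hf : IsPath f)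
    (h : ∀ g, IsPath g → g 0 = f 0 - xs.length → Φ g = c * Ψ g) :
    stack p γ τ μ xs Φ f = c * stack p γ τ μ xs Ψ f := by
  induction xs generalizing f with
  | nil => exact h f hf (by simp)
  | cons x xs ih =>
    rw [stack_cons, stack_cons]
    have e : ∀ g, IsPath g → g 0 = f 0 + -1 →
        stack p γ τ μ xs Φ g = c * stack p γ τ μ xs Ψ g := by
      intro g hg hg0
      refine ih hg fun g' hg' hg0' => h g' hg' ?_
      rw [hg0', hg0, List.length_cons]
      push_cast
      ring
    rw [transfer_congr hf e, transfer, transfer, Finset.mul_sum]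
    refine Finset.sum_congr rfl fun g _ => ?_
    rw [mul_ite, mul_zero]
    congr 1
    ring

/-- Below the stack, the extra row is frozen: its weights are all of the form `[u + γ]`. -/
theorem transfer_descending {N : ℕ} (p : ℝ) (γ τ : ℂ) (μ : Fin N → ℂ) (z : ℂ)
    (Φ : (Fin (N + 1) → ℤ) → ℂ) :
    transfer p γ τ μ 1 1 z Φ (descending N 0) =
      (∏ j, theta p (z - μ j + γ)) * Φ (descending N 1) := by
  have h1 : descending N 1 ∈ neighbors (descending N 0) := by
    rw [mem_neighbors]
    intro i
    simp only [descending]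
    omega
  rw [transfer, Finset.sum_eq_single_of_mem _ h1]
  · rw [if_pos (by simp [descending])]
    congr 1
    refine Finset.prod_congr rfl fun j _ => ?_
    rw [weight, if_pos]
    simp only [descending, Fin.val_succ, Fin.val_castSucc]
    push_cast
    omega
  · intro g hg hne
    split_ifs with hc
    · by_contra hw
      refine hne ((isPath_of_rowWeight_ne_zero (isPath_descending N 0) hg
        (left_ne_zero_of_mul hw)).eq_descending ?_ ?_)
      · rw [hc.1]
        simp [descending]
      · rw [hc.2]
        simp [descending]
    · rfl

theorem prod_div_telescope {n : ℕ} (a : ℕ → ℂ) (ha : ∀ k, a k ≠ 0) :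
    ∏ j : Fin n, a (j + 1) / a j = a n / a 0 := by
  induction n with
  | zero => simp [ha 0]
  | succ n ih =>
    rw [Fin.prod_univ_castSucc]
    simp only [Fin.val_castSucc, Fin.val_last]
    rw [ih, mul_comm, div_mul_div_cancel₀ (ha n)]

/-- Above the stack, the extra row is frozen too, and its dynamical factors telescope. -/
theorem transfer_single_ascending {N : ℕ} {p : ℝ} {γ τ : ℂ}
    (hτ : ∀ k : ℤ, theta p (τ + k * γ) ≠ 0) (μ : Fin N → ℂ) (z : ℂ) {g : Fin (N + 1) → ℤ}
    (hg : IsPath g) (hg0 : g 0 = 0) :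
    transfer p γ τ μ 1 1 z (Pi.single (ascending N 1) 1) g =
      (∏ j, theta p (z - μ j)) * (theta p (τ + ((N : ℂ) + 2) * γ) / theta p (τ + 2 * γ)) *
        (Pi.single (ascending N 0) 1 : (Fin (N + 1) → ℤ) → ℂ) g := by
  by_cases hga : g = ascending N 0
  · subst hga
    have h1 : ascending N 1 ∈ neighbors (ascending N 0) := by
      rw [mem_neighbors]
      intro i
      simp only [ascending]
      omega
    rw [transfer, Finset.sum_eq_single_of_mem _ h1, if_pos (by simp [ascending]), Pi.single_eq_same,
      Pi.single_eq_same, mul_one, mul_one]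
    · have ht := prod_div_telescope (n := N) (fun k => theta p (τ + ((k : ℂ) + 2) * γ))
        (fun k => by exact_mod_cast hτ (k + 2))
      simp only [Nat.cast_zero, zero_add] at ht
      rw [← ht, ← Finset.prod_mul_distrib, rowWeight]
      refine Finset.prod_congr rfl fun j _ => ?_
      have e1 : ascending N 1 j.castSucc = ascending N 0 j.succ := by
        simp [ascending]
      have e2 : ascending N 0 j.castSucc ≠ ascending N 1 j.succ := by
        simp only [ascending, Fin.val_succ, Fin.val_castSucc]
        push_cast
        omega
      have e3 : ascending N 0 j.succ = j + 1 := by simp [ascending]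
      have e4 : ascending N 0 j.castSucc = j := by simp [ascending]
      rw [weight, if_neg (fun h => h.1 e1), if_pos ⟨e1, e2⟩, e1, e3, e4]
      have e5 : τ + ((((j : ℕ) : ℤ) + 1 : ℤ) + 1 : ℂ) * γ = τ + ((j : ℂ) + 2) * γ := by
        push_cast
        ring
      have e6 : τ + ((j : ℂ) + 2) * γ + (((((j : ℕ) : ℤ) + 1 : ℤ) : ℂ) - (((j : ℕ) : ℤ) : ℂ)) * γ =
          τ + (((j + 1 : ℕ) : ℂ) + 2) * γ := by
        push_cast
        ring
      rw [e5, e6]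
      ring
    · intro h _ hne
      rw [Pi.single_eq_of_ne hne, mul_zero, ite_self]
  · rw [Pi.single_eq_of_ne hga, mul_zero, transfer]
    refine Finset.sum_eq_zero fun h _ => ?_
    split_ifs with hc
    · by_cases hh : h = ascending N 1
      · refine absurd (hg.eq_ascending hg0 ?_) hga
        have := hc.2
        rw [hh] at this
        simp only [ascending, Fin.val_last] at this
        omega
      · rw [Pi.single_eq_of_ne hh, mul_zero]
    · rfl

/-- The partition function with one more row, of spectral parameter `z`: below the other rows it
contributes the left-hand side, in which only the product depends on `z`. -/
theorem extra_row {L : ℕ} {p : ℝ} (hp0 : 0 < p) (hp1 : p < 1) {γ τ : ℂ}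
    (hτ : ∀ k : ℤ, theta p (τ + k * γ) ≠ 0) (μ x : Fin L → ℂ) (z : ℂ)
    (hx : ∀ i j, i ≠ j → theta p (x i - x j) ≠ 0) (hz : ∀ j, theta p (z - x j) ≠ 0) :
    (∏ j, theta p (z - μ j + γ)) *
        stack p γ τ μ (List.ofFn x) (Pi.single (ascending L 1) 1) (descending L 1) =
      (∏ j, passing p γ (z - x j)) * (∏ j, theta p (z - μ j)) * Z p γ τ μ x -
      ∑ i, theta p γ * theta p (τ + ((L : ℂ) + 1) * γ + z - x i) /
          (theta p (τ + ((L : ℂ) + 1) * γ) * theta p (z - x i)) *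
        (∏ j, theta p (x i - μ j)) * (∏ j ∈ Finset.univ.erase i, passing p γ (x i - x j)) *
        Z p γ τ μ (Function.update x i z) := by
  have h := transfer_stack hp0 hp1 hτ μ x z hx hz (Pi.single (ascending L 1) 1)
    (isPath_descending L 0) (H := τ + ((L : ℂ) + 1) * γ) (by simp [descending])
  have top : ∀ (y : Fin L → ℂ) (w : ℂ), stack p γ τ μ (List.ofFn y)
      (transfer p γ τ μ 1 1 w (Pi.single (ascending L 1) 1)) (descending L 0) =
      (∏ j, theta p (w - μ j)) * (theta p (τ + ((L : ℂ) + 2) * γ) / theta p (τ + 2 * γ)) *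
        Z p γ τ μ y := by
    intro y w
    rw [Z_eq_stack]
    refine stack_congr_mul _ (isPath_descending L 0) fun g hg hg0 => ?_
    refine transfer_single_ascending hτ μ w hg ?_
    rw [hg0, List.length_ofFn]
    simp [descending]
  have n1 : theta p (τ + ((L : ℂ) + 2) * γ) ≠ 0 := by exact_mod_cast hτ (L + 2)
  have n2 : theta p (τ + 2 * γ) ≠ 0 := by exact_mod_cast hτ 2
  have e1 : τ + ((L : ℂ) + 1) * γ + γ = τ + ((L : ℂ) + 2) * γ := by ring
  have e2 : τ + ((L : ℂ) + 2) * γ - L * γ = τ + 2 * γ := by ring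
  rw [transfer_descending, e1, e2] at h
  simp only [top] at h
  rw [← mul_right_inj' n1, h, mul_sub, mul_sub, Finset.mul_sum, Finset.mul_sum]
  congr 1
  · field_simp
  · refine Finset.sum_congr rfl fun i _ => ?_
    rw [← add_sub_assoc]
    generalize theta p γ * theta p (τ + ((L : ℂ) + 1) * γ + z - x i) /
          (theta p (τ + ((L : ℂ) + 1) * γ) * theta p (z - x i)) = c
    field_simp

/-! ### Generic dynamical parameter, and continuity -/

theorem coeffNbar_eq {L : ℕ} {p : ℝ} (hp0 : 0 < p) (γ τ : ℂ) (μ x : Fin L → ℂ) (z : ℂ)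
    (i : Fin L) : coeffNbar p γ τ μ x z i = -coeffN p γ τ μ x z i := by
  rw [coeffNbar, coeffN, ← neg_sub z (x i), theta_neg hp0, mul_neg, div_neg, neg_mul, neg_mul]

/-- The right-hand side does not depend on `z`. Its value is the partition function on heights
raised by one, that is, with `τ + γ` in place of `τ`. -/
theorem relation_of_generic {L : ℕ} {p : ℝ} (hp0 : 0 < p) (hp1 : p < 1) {γ τ : ℂ}
    (hτ : ∀ k : ℤ, theta p (τ + k * γ) ≠ 0) (μ x : Fin L → ℂ) (z : ℂ)
    (hx : ∀ i j, i ≠ j → theta p (x i - x j) ≠ 0) (hz : ∀ j, theta p (z - x j) ≠ 0)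
    (hμ : ∀ j, theta p (z - μ j + γ) ≠ 0) :
    stack p γ τ μ (List.ofFn x) (Pi.single (ascending L 1) 1) (descending L 1) =
      (∏ j, (theta p (z - μ j) * theta p (z - x j + γ)) /
        (theta p (z - μ j + γ) * theta p (z - x j))) * Z p γ τ μ x -
      ∑ i, coeffN p γ τ μ x z i * Z p γ τ μ (Function.update x i z) := by
  have hP : ∏ j, theta p (z - μ j + γ) ≠ 0 := Finset.prod_ne_zero_iff.2 fun j _ => hμ j
  rw [← mul_right_inj' hP, extra_row hp0 hp1 hτ μ x z hx hz, mul_sub, Finset.mul_sum]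
  congr 1
  · simp only [passing, Finset.prod_div_distrib, Finset.prod_mul_distrib]
    field_simp
  · refine Finset.sum_congr rfl fun i _ => ?_
    rw [coeffN, Finset.prod_div_distrib]
    simp only [passing]
    generalize theta p γ * theta p (τ + ((L : ℂ) + 1) * γ + z - x i) /
          (theta p (τ + ((L : ℂ) + 1) * γ) * theta p (z - x i)) = c
    field_simp

theorem dense_generic {p : ℝ} (hp0 : 0 < p) (hp1 : p < 1) {z : ℂ} (hz : theta p z ≠ 0) (γ : ℂ) :
    Dense {τ : ℂ | ∀ k : ℤ, theta p (τ + k * γ) ≠ 0} := by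
  have e : {τ : ℂ | ∀ k : ℤ, theta p (τ + k * γ) ≠ 0} =
      ⋂ k : ℤ, {τ : ℂ | theta p (τ + k * γ) ≠ 0} := by
    ext τ
    simp
  rw [e]
  refine dense_iInter_of_isOpen (fun k => ?_) fun k => dense_theta_ne_zero hp0 hp1 hz _
  exact isOpen_ne_fun ((continuous_theta hp0 hp1).comp (continuous_add_const _)) continuous_const

theorem continuousAt_Z {L : ℕ} {p : ℝ} (hp0 : 0 < p) (hp1 : p < 1) {γ τ : ℂ} (μ x : Fin L → ℂ)
    (hτ : ∀ k ∈ Finset.Icc 1 (L + 1), theta p (τ + (k : ℂ) * γ) ≠ 0) :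
    ContinuousAt (fun τ => Z p γ τ μ x) τ := by
  unfold Z
  refine tendsto_finsetSum _ fun n hn => tendsto_finsetProd _ fun i _ =>
    tendsto_finsetProd _ fun j _ => ?_
  have hn' : IsConfig L n := by simpa using hn
  -- the heights of a configuration lie between `0` and `L`, so only `[τ + γ], …, [τ + (L + 1) γ]`
  -- occur in denominators
  have hH : theta p (τ + ((n i.succ j.castSucc : ℂ) + 1) * γ) ≠ 0 := by
    have hb := IsPath.bounds (hn'.horiz i.succ) j.castSucc
    rw [hn'.first_col, hn'.last_col] at hb
    obtain ⟨k, hk⟩ := Int.eq_ofNat_of_zero_le (a := n i.succ j.castSucc) (by omega)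
    have := hτ (k + 1) (by rw [Finset.mem_Icc]; omega)
    rw [hk]
    exact_mod_cast this
  have hc := continuous_theta hp0 hp1
  change ContinuousAt (fun τ => weight p γ τ (x i - μ j) _ _ _ _) τ
  have h1 : ∀ v : ℂ, ContinuousAt (fun τ => theta p (τ + v)) τ := fun v =>
    (hc.comp (continuous_add_const v)).continuousAt
  have h2 : ∀ v w : ℂ, ContinuousAt (fun τ => theta p (τ + v + w)) τ := fun v w =>
    (hc.comp ((continuous_add_const v).add continuous_const)).continuousAt
  unfold weight
  simp only
  split_ifs
  · exact continuousAt_const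
  · exact ((h2 _ _).mul continuousAt_const).div (h1 _) hH
  · exact ((h2 _ _).mul continuousAt_const).div (h1 _) hH
  · exact continuousAt_const

theorem continuousAt_coeffN {L : ℕ} {p : ℝ} (hp0 : 0 < p) (hp1 : p < 1) {γ τ : ℂ}
    (μ x : Fin L → ℂ) {z : ℂ} (i : Fin L) (hz : theta p (z - x i) ≠ 0)
    (hτ : theta p (τ + ((L : ℂ) + 1) * γ) ≠ 0) :
    ContinuousAt (fun τ => coeffN p γ τ μ x z i) τ := by
  have hc := continuous_theta hp0 hp1
  unfold coeffN
  have h1 : Continuous fun τ => theta p γ * theta p (τ + ((L : ℂ) + 1) * γ + z - x i) := by fun_prop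
  have h2 : Continuous fun τ => theta p (τ + ((L : ℂ) + 1) * γ) * theta p (z - x i) := by fun_prop
  exact ((h1.continuousAt.div h2.continuousAt (mul_ne_zero hτ hz)).mul continuousAt_const).mul
    continuousAt_const

end

end SOS

theorem lemma2 (L : ℕ) (p : ℝ) (hp0 : 0 < p) (hp1 : p < 1) (γ τ : ℂ)
    (μ x : Fin L → ℂ) (x₀ xb : ℂ)
    (hτ : ∀ k ∈ Finset.Icc 1 (L + 1), SOS.theta p (τ + (k : ℂ) * γ) ≠ 0)
    (hx : ∀ i j : Fin L, i ≠ j → SOS.theta p (x i - x j) ≠ 0)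
    (hx₀ : ∀ j : Fin L, SOS.theta p (x₀ - x j) ≠ 0)
    (hxb : ∀ j : Fin L, SOS.theta p (xb - x j) ≠ 0)
    (hμ₀ : ∀ j : Fin L, SOS.theta p (x₀ - μ j + γ) ≠ 0)
    (hμb : ∀ j : Fin L, SOS.theta p (xb - μ j + γ) ≠ 0) :
    SOS.coeffM p γ μ x x₀ xb * SOS.Z p γ τ μ x
      + ∑ i : Fin L, SOS.coeffN p γ τ μ x x₀ i * SOS.Z p γ τ μ (Function.update x i x₀)
      + ∑ i : Fin L, SOS.coeffNbar p γ τ μ x xb i * SOS.Z p γ τ μ (Function.update x i xb)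
      = 0 := by
  have hL : SOS.theta p (τ + ((L : ℂ) + 1) * γ) ≠ 0 := by
    have := hτ (L + 1) (by simp)
    exact_mod_cast this
  simp only [SOS.coeffNbar_eq hp0]
  set F : ℂ → ℂ := fun t => SOS.coeffM p γ μ x x₀ xb * SOS.Z p γ t μ x
      + ∑ i : Fin L, SOS.coeffN p γ t μ x x₀ i * SOS.Z p γ t μ (Function.update x i x₀)
      + ∑ i : Fin L, -SOS.coeffN p γ t μ x xb i * SOS.Z p γ t μ (Function.update x i xb) with hF
  -- for generic `t` the relations with `z = x₀` and `z = xb` have the same left-hand side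
  have hgen : ∀ t : ℂ, (∀ k : ℤ, SOS.theta p (t + k * γ) ≠ 0) → F t = 0 := by
    intro t ht
    have h0 := SOS.relation_of_generic hp0 hp1 ht μ x x₀ hx hx₀ hμ₀
    have hb := SOS.relation_of_generic hp0 hp1 ht μ x xb hx hxb hμb
    simp only [hF, SOS.coeffM, neg_mul, Finset.sum_neg_distrib]
    linear_combination h0 - hb
  have hcont : ContinuousAt F τ := by
    have hZ := fun y : Fin L → ℂ => SOS.continuousAt_Z hp0 hp1 μ y hτ
    refine ((continuousAt_const.mul (hZ x)).add (tendsto_finsetSum _ fun i _ => ?_)).add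
      (tendsto_finsetSum _ fun i _ => ?_)
    · exact (SOS.continuousAt_coeffN hp0 hp1 μ x i (hx₀ i) hL).mul (hZ _)
    · exact (SOS.continuousAt_coeffN hp0 hp1 μ x i (hxb i) hL).neg.mul (hZ _)
  by_contra hne
  obtain ⟨t, ht, ht'⟩ := ((mem_closure_iff_frequently.1
    (SOS.dense_generic hp0 hp1 hL γ τ)).and_eventually (hcont.eventually_ne hne)).exists
  exact ht' (hgen t ht)
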